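/- Consider $N\ge 1$ classes of status packets sharing a single server with an infinite buffer, which serves packets first-come-first-served, without idling while a packet is present. Class-$n$ packets arrive (are generated) according to a Poisson process of rate $\lambda_n>0$; class-$n$ service times are positive and i.i.d. with mean $x_n$ and finite second moment $y_n$; the arrival processes of all classes and the service times of all packets are independent. The system is empty at time $0$. Assume $\rho:=\sum_{j=1}^N\lambda_jx_j<1$. The status age $\Delta_n(t)$ of class $n$ is the time elapsed at time $t$ since the generation of the latest class-$n$ packet received (i.e. whose service was completed) up to time $t$; before the first reception it is counted from time $0$. Let $A_{nk}$ be the $k$-th peak of $\Delta_n$, i.e. its left limit at the time of reception of the $k$-th class-$n$ packet. Let $W^{(i)}$ be the waiting time (time from arrival to start of service) of the $i$-th packet of the system in order of arrival. Then for every class $n$ the peak age-of-information $A_{p,n}:=\lim_{K\to\infty}\frac1K\sum_{k=1}^KA_{nk}$ exists almost surely, and almost surely $$A_{p,n}=\frac1{\lambda_n}+x_n+\frac{\sum_j\lambda_jy_j}{2\bigl(1-\sum_j\lambda_jx_j\bigr)} .$$ Moreover the mean waiting time $W:=\lim_{K\to\infty}\frac1K\sum_{i=1}^KW^{(i)}$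 exists almost surely and equals $\frac{\sum_j\lambda_jy_j}{2(1-\rho)}$. Consequently the conservation law $$\sum_{n=1}^N\lambda_nA_{p,n}=N+\rho+\Bigl(\sum_{n=1}^N\lambda_n\Bigr)W$$ holds, and for all classes $n,m$ $$A_{p,n}-\frac1{\lambda_n}-x_n=A_{p,m}-\frac1{\lambda_m}-x_m,\qquad \frac1{\lambda_n}-\frac1{\lambda_m}=(A_{p,n}-x_n)-(A_{p,m}-x_m);$$ in particular $\lambda_m>\lambda_n$ implies $A_{p,n}-x_n>A_{p,m}-x_m$. -/

import Mathlib

open MeasureTheory ProbabilityTheory Filter Topology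

noncomputable section

namespace MG1

/-! ### One sample path of the queue

`I n 0` is the time of the first class-`n` arrival, `I n (k+1)` is the time between the `k`-th and
the `(k+1)`-st class-`n` packet, and `X n k` is the service time of the `k`-th class-`n` packet; `k` starts at `0`.
The system is empty at time `0`. -/

/-- The generation (= arrival) time of the `k`-th packet of class `n`. -/
def arrivalTime {N : ℕ} (I : Fin N → ℕ → ℝ) (n : Fin N) (k : ℕ) : ℝ :=
  ∑ i ∈ Finset.range (k + 1), I n i

/-- A class at which `f` is minimal. -/
def earliest {N : ℕ} [NeZero N] (f : Fin N → ℝ) : Fin N :=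
  Classical.choose (Finite.exists_min f)

/-- All packets, of whatever class, are numbered `0, 1, 2, …` in the order of their arrival.
`arrivedBefore I i n` is the number of class-`n` packets among the first `i` packets; the `i`-th
packet is of the class whose next packet arrives first. -/
def arrivedBefore {N : ℕ} [NeZero N] (I : Fin N → ℕ → ℝ) : ℕ → Fin N → ℕ
  | 0 => fun _ => 0
  | i + 1 =>
    Function.update (arrivedBefore I i)
      (earliest fun m => arrivalTime I m (arrivedBefore I i m))
      (arrivedBefore I i (earliest fun m => arrivalTime I m (arrivedBefore I i m)) + 1)

/-- The class of the `i`-th packet in the order of arrival. -/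
def packetClass {N : ℕ} [NeZero N] (I : Fin N → ℕ → ℝ) (i : ℕ) : Fin N :=
  earliest fun m => arrivalTime I m (arrivedBefore I i m)

/-- The generation time of the `i`-th packet in the order of arrival. -/
def generationTime {N : ℕ} [NeZero N] (I : Fin N → ℕ → ℝ) (i : ℕ) : ℝ :=
  arrivalTime I (packetClass I i) (arrivedBefore I i (packetClass I i))

/-- The service time of the `i`-th packet in the order of arrival. -/
def serviceTime {N : ℕ} [NeZero N] (I X : Fin N → ℕ → ℝ) (i : ℕ) : ℝ :=
  X (packetClass I i) (arrivedBefore I i (packetClass I i))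

/-- The time at which the service of the `i`-th packet begins: there is a single server, and it
serves the packets in the order of arrival, never idling while a packet is present. -/
def serviceStart {N : ℕ} [NeZero N] (I X : Fin N → ℕ → ℝ) : ℕ → ℝ
  | 0 => generationTime I 0
  | i + 1 => max (generationTime I (i + 1)) (serviceStart I X i + serviceTime I X i)

/-- The time at which the `i`-th packet leaves the queue, i.e. is received. -/
def receptionTime {N : ℕ} [NeZero N] (I X : Fin N → ℕ → ℝ) (i : ℕ) : ℝ :=
  serviceStart I X i + serviceTime I X i

/-- The waiting time of the `i`-th packet (its service time not included). -/
def waitingTime {N : ℕ} [NeZero N] (I X : Fin N → ℕ → ℝ) (i : ℕ) : ℝ :=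
  serviceStart I X i - generationTime I i

/-- The status age `Δ_n(t)`, for `t ≥ 0`: the time elapsed at time `t` since the generation of the
latest class-`n` packet received up to time `t`. As long as no class-`n` packet has been received,
the age is counted from time `0`. -/
def age {N : ℕ} [NeZero N] (I X : Fin N → ℕ → ℝ) (n : Fin N) (t : ℝ) : ℝ :=
  t - sSup ({0} ∪
    {g | ∃ i : ℕ, packetClass I i = n ∧ receptionTime I X i ≤ t ∧ g = generationTime I i})

/-- The time at which the `k`-th class-`n` packet is received; this is the `k`-th time at which
the status age of class `n` drops. -/
def dropTime {N : ℕ} [NeZero N] (I X : Fin N → ℕ → ℝ) (n : Fin N) (k : ℕ) : ℝ :=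
  receptionTime I X (Nat.nth (fun i => packetClass I i = n) k)

/-- The `k`-th peak `A_{nk}` of the status age of class `n`: the value reached by the age just
before its `k`-th drop. -/
def peakAge {N : ℕ} [NeZero N] (I X : Fin N → ℕ → ℝ) (n : Fin N) (k : ℕ) : ℝ :=
  Function.leftLim (age I X n) (dropTime I X n k)

/-! ### The stochastic model -/

/-- The primitives of the multi-class `M/G/1` queue: the classes have independent Poisson arrival
streams (i.i.d. exponential inter-arrival times) of rates `lam n`, and the service times of class
`n` are positive, i.i.d. with mean `x n` and second moment `y n`, independent of everything else. -/
structure IsMultiClassMG1 {N : ℕ} {Ω : Type*} [MeasurableSpace Ω] (μ : Measure Ω)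
    (lam x y : Fin N → ℝ) (I X : Fin N → ℕ → Ω → ℝ) : Prop where
  rate_pos : ∀ n, 0 < lam n
  measurable_interarrival : ∀ n k, Measurable (I n k)
  measurable_service : ∀ n k, Measurable (X n k)
  indep : iIndepFun (fun p : (Fin N × ℕ) ⊕ (Fin N × ℕ) =>
    Sum.elim (fun q => I q.1 q.2) (fun q => X q.1 q.2) p) μ
  interarrival_law : ∀ n k, HasLaw (I n k) (expMeasure (lam n)) μ
  service_identDistrib : ∀ n k, IdentDistrib (X n k) (X n 0) μ μ
  service_pos : ∀ n k, ∀ᵐ ω ∂μ, 0 < X n k ω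
  service_memLp : ∀ n, MemLp (X n 0) 2 μ
  service_mean : ∀ n, ∫ ω, X n 0 ω ∂μ = x n
  service_secondMoment : ∀ n, ∫ ω, (X n 0 ω) ^ 2 ∂μ = y n

/-- `a` is the peak age-of-information of class `n`: almost surely, the average of the first `K`
peaks of the status age converges to `a` as `K → ∞`. -/
def IsPeakAoI {N : ℕ} [NeZero N] {Ω : Type*} [MeasurableSpace Ω] (μ : Measure Ω)
    (I X : Fin N → ℕ → Ω → ℝ) (n : Fin N) (a : ℝ) : Prop :=
  ∀ᵐ ω ∂μ, Tendsto
    (fun K : ℕ => (1 / (K : ℝ)) * ∑ k ∈ Finset.range K,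
      peakAge (fun m j => I m j ω) (fun m j => X m j ω) n k)
    atTop (𝓝 a)

/-- `w` is the mean waiting time: almost surely, the average waiting time of the first `K` packets
converges to `w` as `K → ∞`. -/
def IsMeanWaitingTime {N : ℕ} [NeZero N] {Ω : Type*} [MeasurableSpace Ω] (μ : Measure Ω)
    (I X : Fin N → ℕ → Ω → ℝ) (w : ℝ) : Prop :=
  ∀ᵐ ω ∂μ, Tendsto
    (fun K : ℕ => (1 / (K : ℝ)) * ∑ i ∈ Finset.range K,
      waitingTime (fun m j => I m j ω) (fun m j => X m j ω) i)
    atTop (𝓝 w)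

end MG1

end

/-! Service is in order of arrival, so the class-`n` packet received before the `k`-th one is the
`(k - 1)`-st, and on each path the peak is `I n k + X n k` plus the waiting time of the `k`-th
class-`n` packet (`peakAge_eq`). The strong law averages the first two terms to `1 / lam n` and `x
n`. What remains is the average wait over the packets of one class, which has to be shown not to
depend on the class.

By memorylessness, the merged arrivals form one Poisson stream whose packets carry i.i.d. marks
(class, service time), independent of the interarrival times (`map_firstPacket_nextStreams`,
`map_iterate_eq_infinitePi`, `IsMultiClassMG1.exists_packets`). The waits follow Lindley's
recursion, and the wait of a packet is independent of its mark; hence all classes see the same mean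
wait.

The Pollaczek–Khinchine value is obtained as an almost sure limit, without stationarity or
regeneration. If `T` is exponential of rate `λ` and `u ≥ 0`, then `E[(u - T)⁺] = (λ/2) (u² - E[((u -
T)⁺)²])`. With `u = W i + S i` the squares telescope over `i`: up to martingales, `(1 - λ s) ∑ W i`
is `(λ/2) ∑ (S i)²` minus nonnegative boundary terms. Dropping these terms gives the upper bound.
They vanish at the last index with zero wait, which is `n - o(n)` because the drift is negative;
this gives the lower bound (`tendsto_lindley_average`).

Service times have only two moments, so a second moment bound on the waits is not available. The
martingales are therefore normalized by the random sums of `1 + W j + S j`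
(`ae_tendsto_sum_div_of_indep`): a pathwise estimate makes the normalized variances summable
(`exists_sum_lindley_sq_le`), Kronecker's lemma applies, and the energy identity then shows that the
normalizer grows only linearly. -/

namespace MG1

/-! ### Real analysis -/

/-- **Kronecker's lemma**. -/
lemma tendsto_sum_mul_div_of_tendsto_sum {a b : ℕ → ℝ} {s : ℝ} (hb : Monotone b)
    (hbpos : ∀ n, 0 < b n) (hbtop : Tendsto b atTop atTop)
    (ha : Tendsto (fun n => ∑ i ∈ Finset.range n, a i) atTop (𝓝 s)) :
    Tendsto (fun n => (∑ i ∈ Finset.range n, b i * a i) / b n) atTop (𝓝 0) := by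
  set σ : ℕ → ℝ := fun n => ∑ i ∈ Finset.range n, a i with hσ
  -- Summation by parts, centred at the limit `s`: the remaining sum averages a null sequence with
  -- weights `b (i + 1) - b i`.
  have abel : ∀ n, ∑ i ∈ Finset.range n, b i * a i =
      b n * (σ n - s) - ∑ i ∈ Finset.range n, (b (i + 1) - b i) * (σ (i + 1) - s) + b 0 * s := by
    intro n
    induction n with
    | zero => simp [hσ]
    | succ n ih =>
      have : σ (n + 1) = σ n + a n := Finset.sum_range_succ _ _
      rw [Finset.sum_range_succ, ih, Finset.sum_range_succ, this]; ring
  have hσs : Tendsto (fun n => σ n - s) atTop (𝓝 0) := by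
    simpa using ha.sub_const s
  have hlo : (fun n => ∑ i ∈ Finset.range n, (b (i + 1) - b i) * (σ (i + 1) - s)) =o[atTop]
      (fun n => ∑ i ∈ Finset.range n, (b (i + 1) - b i)) := by
    apply Asymptotics.IsLittleO.sum_range
    · have h1 : (fun n => σ (n + 1) - s) =o[atTop] (fun _ => (1 : ℝ)) :=
        (Asymptotics.isLittleO_one_iff ℝ).2 ((tendsto_add_atTop_iff_nat 1).2 hσs)
      simpa using (Asymptotics.isBigO_refl (fun n => b (n + 1) - b n) atTop).mul_isLittleO h1
    · intro n; simpa using hb (Nat.le_succ n)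
    · simp_rw [Finset.sum_range_sub]
      exact tendsto_atTop_add_const_right _ _ hbtop
  have hbig : (fun n => ∑ i ∈ Finset.range n, (b (i + 1) - b i)) =O[atTop] b := by
    refine Asymptotics.IsBigO.of_bound 1 (Eventually.of_forall fun n => ?_)
    rw [Finset.sum_range_sub, one_mul, Real.norm_of_nonneg (hbpos n).le,
      Real.norm_of_nonneg (sub_nonneg.2 (hb (Nat.zero_le n)))]
    linarith [hbpos 0]
  have h2 := (hlo.trans_isBigO hbig).tendsto_div_nhds_zero
  have h3 : Tendsto (fun n => b 0 * s / b n) atTop (𝓝 0) := hbtop.const_div_atTop _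
  have h4 := (hσs.sub h2).add h3
  simp only [sub_zero, add_zero] at h4
  refine h4.congr fun n => ?_
  rw [abel]
  have := (hbpos n).ne'
  field_simp

/-- If `V i ≤ c A i ^ (3 / 4)`, where `A` are the partial sums of `V ≥ 1`, then `∑ (V i / A i) ^ 2`
has bounded partial sums. Here `q i` is the fourth root of `A i`. -/
lemma sum_sq_div_sum_sq_le {V q : ℕ → ℝ} {c : ℝ} (hc : 0 ≤ c) (hV : ∀ i, 1 ≤ V i)
    (hq : ∀ i, 0 < q i) (hqA : ∀ i, q i ^ 4 = ∑ j ∈ Finset.range (i + 1), V j)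
    (hVq : ∀ i, V i ≤ c * q i ^ 3) (n : ℕ) :
    ∑ i ∈ Finset.range n, (V i / ∑ j ∈ Finset.range (i + 1), V j) ^ 2 ≤
      (V 0 / q 0 ^ 4) ^ 2 + 4 * c / q 0 := by
  -- A discrete form of the convergence of `∫ A ^ (-5/4) dA`. One factor `V` is bounded by `c a ^
  -- 3`, the other, being the increment `a ^ 4 - b ^ 4`, by `4 a ^ 3 (a - b)`; weakening `a * a` to
  -- `b * a` in the denominator makes the bound telescope.
  have step : ∀ i, (V (i + 1) / q (i + 1) ^ 4) ^ 2 ≤ 4 * c * (1 / q i - 1 / q (i + 1)) := by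
    intro i
    set a := q (i + 1) with ha
    set b := q i with hb
    have ha0 : 0 < a := hq _
    have hb0 : 0 < b := hq _
    have hVe : V (i + 1) = a ^ 4 - b ^ 4 := by
      rw [ha, hb, hqA, hqA, Finset.sum_range_succ _ (i + 1)]; ring
    have hba : b ≤ a := by
      by_contra h
      push Not at h
      have := pow_le_pow_left₀ ha0.le h.le 4
      linarith [hV (i + 1)]
    have h1 : V (i + 1) ≤ 4 * a ^ 3 * (a - b) := by
      have e : a ^ 4 - b ^ 4 = (a - b) * (a ^ 3 + a ^ 2 * b + a * b ^ 2 + b ^ 3) := by ring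
      have : a ^ 3 + a ^ 2 * b + a * b ^ 2 + b ^ 3 ≤ 4 * a ^ 3 := by
        have h1 : b ^ 2 ≤ a ^ 2 := pow_le_pow_left₀ hb0.le hba 2
        have h2 : b ^ 3 ≤ a ^ 3 := pow_le_pow_left₀ hb0.le hba 3
        nlinarith [mul_le_mul_of_nonneg_left hba (sq_nonneg a),
          mul_le_mul_of_nonneg_left h1 ha0.le]
      rw [hVe, e, mul_comm (4 * a ^ 3)]
      exact mul_le_mul_of_nonneg_left this (by linarith)
    have hV0 : 0 ≤ V (i + 1) := by linarith [hV (i + 1)]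
    have h2 : V (i + 1) ^ 2 ≤ (c * a ^ 3) * (4 * a ^ 3 * (a - b)) := by
      rw [sq]; exact mul_le_mul (hVq _) h1 hV0 (by positivity)
    calc (V (i + 1) / a ^ 4) ^ 2 = V (i + 1) ^ 2 / a ^ 8 := by ring
      _ ≤ (c * a ^ 3) * (4 * a ^ 3 * (a - b)) / a ^ 8 := by gcongr
      _ = 4 * c * ((a - b) / (a * a)) := by field_simp
      _ ≤ 4 * c * ((a - b) / (b * a)) := by
          have : 0 ≤ a - b := by linarith
          gcongr
      _ = 4 * c * (1 / b - 1 / a) := by field_simp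
  have main : ∀ n, ∑ i ∈ Finset.range (n + 1), (V i / q i ^ 4) ^ 2 ≤
      (V 0 / q 0 ^ 4) ^ 2 + 4 * c * (1 / q 0 - 1 / q n) := by
    intro n
    induction n with
    | zero => simp
    | succ n ih => rw [Finset.sum_range_succ]; linarith [step n]
  simp_rw [← hqA]
  refine (Finset.sum_le_sum_of_subset_of_nonneg (Finset.range_mono (Nat.le_succ n))
    fun _ _ _ => sq_nonneg _).trans ((main n).trans ?_)
  have : 0 ≤ 1 / q n := by have := hq n; positivity
  have h4 : 4 * c / q 0 = 4 * c * (1 / q 0) := by ring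
  rw [h4]
  gcongr
  linarith

/-! ### Waiting times of a single path of the Lindley recursion -/

/-- The waiting times of successive customers of a single server queue with service times `S i`,
where `T (i + 1)` is the time between the arrivals of the `i`-th and the `(i + 1)`-st customer. -/
noncomputable def lindley (S T : ℕ → ℝ) : ℕ → ℝ
  | 0 => 0
  | i + 1 => max (lindley S T i + S i - T (i + 1)) 0

lemma lindley_nonneg (S T : ℕ → ℝ) : ∀ i, 0 ≤ lindley S T i
  | 0 => le_rfl
  | _ + 1 => le_max_right _ _

lemma sum_range_le_mul_of_tendsto {f : ℕ → ℝ} {l : ℝ}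
    (h : Tendsto (fun n : ℕ => (∑ i ∈ Finset.range n, f i) / n) atTop (𝓝 l)) :
    ∃ C, 0 ≤ C ∧ ∀ n : ℕ, ∑ i ∈ Finset.range n, f i ≤ C * n := by
  obtain ⟨C, hC⟩ := h.bddAbove_range
  refine ⟨max C 0, le_max_right _ _, fun n => ?_⟩
  rcases Nat.eq_zero_or_pos n with rfl | hn
  · simp
  · have h1 : (∑ i ∈ Finset.range n, f i) / n ≤ C := hC ⟨n, rfl⟩
    have hn' : (0 : ℝ) < n := by exact_mod_cast hn
    rw [div_le_iff₀ hn'] at h1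
    exact h1.trans (by gcongr; exact le_max_left _ _)

/-- The square-summability which is needed for the martingale law of large numbers. -/
lemma exists_sum_lindley_sq_le {S T : ℕ → ℝ} {σ : ℝ} (hS : ∀ i, 0 ≤ S i) (hT : ∀ i, 0 ≤ T i)
    (hS2 : Tendsto (fun n : ℕ => (∑ i ∈ Finset.range n, S i ^ 2) / n) atTop (𝓝 σ)) :
    ∃ c : ℝ, ∀ n, ∑ i ∈ Finset.range n, ((1 + (lindley S T i + S i)) /
      ∑ j ∈ Finset.range (i + 1), (1 + (lindley S T j + S j))) ^ 2 ≤ c := by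
  obtain ⟨C, hC0, hC⟩ := sum_range_le_mul_of_tendsto hS2
  set V : ℕ → ℝ := fun i => 1 + (lindley S T i + S i) with hVdef
  set A : ℕ → ℝ := fun i => ∑ j ∈ Finset.range (i + 1), V j with hA
  have hV : ∀ i, 1 ≤ V i := fun i => by
    have := lindley_nonneg S T i; have := hS i; simp only [hVdef]; linarith
  have hAge : ∀ i : ℕ, (i + 1 : ℝ) ≤ A i := by
    intro i
    have := Finset.sum_le_sum (s := Finset.range (i + 1)) fun j _ => hV j
    simpa using this
  have hA1 : ∀ i, 1 ≤ A i := fun i => by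
    have := hAge i; have : (0 : ℝ) ≤ i := Nat.cast_nonneg i; linarith
  have hSle : ∀ i j, j ≤ i → S j ≤ √C * √(A i) := by
    intro i j hji
    rw [← Real.sqrt_mul hC0]
    apply Real.le_sqrt_of_sq_le
    calc S j ^ 2 ≤ ∑ k ∈ Finset.range (i + 1), S k ^ 2 :=
          Finset.single_le_sum (f := fun k => S k ^ 2) (fun _ _ => sq_nonneg _)
            (Finset.mem_range.2 (by omega))
      _ ≤ C * ((i + 1 : ℕ) : ℝ) := hC _
      _ ≤ C * A i := by push_cast; exact mul_le_mul_of_nonneg_left (hAge i) hC0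
  -- `V` grows by at most `S (i + 1)` in a step. Together with `S j ≤ √(C A i)` for `j ≤ i`,
  -- summation gives `V i ^ 2 = O(A i ^ (3/2))`, which is the exponent `3/4` needed.
  have hVstep : ∀ i, V (i + 1) ^ 2 ≤ V i ^ 2 + 2 * (S (i + 1) * V (i + 1)) := by
    intro i
    have h1 : V (i + 1) ≤ V i + S (i + 1) := by
      have : lindley S T (i + 1) ≤ lindley S T i + S i :=
        max_le (by linarith [hT (i + 1)]) (add_nonneg (lindley_nonneg _ _ _) (hS i))
      simp only [hVdef]; linarith
    nlinarith [mul_le_mul_of_nonneg_left h1 (zero_le_one.trans (hV (i + 1))),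
      sq_nonneg (V (i + 1) - V i)]
  have hVsum : ∀ i, V i ^ 2 ≤ V 0 ^ 2 + 2 * ∑ j ∈ Finset.range (i + 1), S j * V j := by
    intro i
    induction i with
    | zero =>
      have := mul_nonneg (hS 0) (by linarith [hV 0] : 0 ≤ V 0)
      simp; linarith
    | succ i ih => rw [Finset.sum_range_succ]; linarith [hVstep i]
  set q : ℕ → ℝ := fun i => √(√(A i)) with hq
  have hqpos : ∀ i, 0 < q i := fun i =>
    Real.sqrt_pos.2 (Real.sqrt_pos.2 (by linarith [hA1 i]))
  have hq2 : ∀ i, q i ^ 2 = √(A i) := fun i => Real.sq_sqrt (Real.sqrt_nonneg _)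
  have hq4 : ∀ i, q i ^ 4 = A i := fun i => by
    rw [show 4 = 2 * 2 from rfl, pow_mul, hq2, Real.sq_sqrt (by linarith [hA1 i])]
  -- The summand `1` ensures `k ≤ k * k`, so that the bound on `V i ^ 2` can be enlarged to a
  -- perfect square.
  set k : ℝ := 1 + V 0 ^ 2 + 2 * √C with hk
  have hk1 : 1 ≤ k := by have := Real.sqrt_nonneg C; have := sq_nonneg (V 0); linarith
  have hVq : ∀ i, V i ≤ k * q i ^ 3 := by
    intro i
    have hq1 : 1 ≤ q i ^ 6 := by
      have : q i ^ 6 = √(A i) * A i := by rw [← hq2 i, ← hq4 i]; ring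
      rw [this]
      have h1 : 1 ≤ √(A i) := Real.one_le_sqrt.2 (hA1 i)
      nlinarith [hA1 i]
    have h1 : ∑ j ∈ Finset.range (i + 1), S j * V j ≤ √C * q i ^ 6 := by
      calc ∑ j ∈ Finset.range (i + 1), S j * V j
          ≤ ∑ j ∈ Finset.range (i + 1), √C * √(A i) * V j := by
            refine Finset.sum_le_sum fun j hj => mul_le_mul_of_nonneg_right
              (hSle i j (by have := Finset.mem_range.1 hj; omega)) (by linarith [hV j])
        _ = √C * q i ^ 6 := by
            rw [← Finset.mul_sum, ← hq2]
            change _ * A i = _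
            rw [← hq4]; ring
    have h2 : V i ^ 2 ≤ (k * q i ^ 3) ^ 2 := by
      calc V i ^ 2 ≤ V 0 ^ 2 + 2 * (√C * q i ^ 6) := (hVsum i).trans (by linarith)
        _ ≤ k * q i ^ 6 := by
            have := mul_le_mul_of_nonneg_left hq1 (sq_nonneg (V 0))
            rw [hk]; nlinarith
        _ ≤ k * k * q i ^ 6 := by
            have : k ≤ k * k := by nlinarith
            gcongr
        _ = (k * q i ^ 3) ^ 2 := by ring
    have := hqpos i
    exact (pow_le_pow_iff_left₀ (by linarith [hV i]) (by positivity) two_ne_zero).1 h2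
  exact ⟨_, sum_sq_div_sum_sq_le (by linarith) hV hqpos hq4 hVq⟩

lemma tendsto_div_natCast_of_le_mul {A D : ℕ → ℝ} (hApos : ∀ n, 0 < A n)
    (hlin : ∃ C : ℝ, ∀ᶠ n : ℕ in atTop, A n ≤ C * n)
    (hDA : Tendsto (fun n => D n / A n) atTop (𝓝 0)) :
    Tendsto (fun n : ℕ => D n / n) atTop (𝓝 0) := by
  obtain ⟨C, hC⟩ := hlin
  have h1 : Tendsto (fun n => |D n / A n| * C) atTop (𝓝 0) := by
    simpa using hDA.abs.mul_const C
  refine squeeze_zero_norm' ?_ h1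
  filter_upwards [hC, eventually_ge_atTop 1] with n hn hn1
  have hn1' : (0 : ℝ) < n := by exact_mod_cast hn1
  rw [Real.norm_eq_abs, abs_div, abs_div, abs_of_pos hn1', abs_of_pos (hApos n),
    div_mul_eq_mul_div, div_le_div_iff₀ hn1' (hApos n), mul_assoc]
  gcongr

/-- Nonnegativity of `W n` forces `Z (l n) ≤ Z n`; both are linear of slope `-δ` up to `o(n)`, so `δ
(n - l n)` is `o(n)`. In the application `Z` is the unreflected random walk and `l n` the last index
up to `n` with zero wait. -/
lemma tendsto_lastZero_div {W Z : ℕ → ℝ} {δ : ℝ} (hδ : 0 < δ) {l : ℕ → ℕ} (hl : ∀ n, l n ≤ n)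
    (hW : ∀ n, 0 ≤ W n) (hWZ : ∀ n, W n = Z n - Z (l n))
    (hZ : Tendsto (fun n : ℕ => Z n / n) atTop (𝓝 (-δ))) :
    Tendsto (fun n : ℕ => (l n : ℝ) / n) atTop (𝓝 1) := by
  -- The bound must hold for all `n`, since nothing yet prevents `l n` from staying small; `K`
  -- absorbs the initial terms.
  have key : ∀ ε > 0, ∃ K : ℝ, 0 ≤ K ∧ ∀ n : ℕ, |Z n + δ * n| ≤ ε * n + K := by
    intro ε hε
    have h1 := Metric.tendsto_atTop.1 hZ ε hε
    obtain ⟨n₀, hn₀⟩ := h1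
    refine ⟨∑ i ∈ Finset.range (n₀ + 1), |Z i + δ * i|,
      Finset.sum_nonneg fun _ _ => abs_nonneg _, fun n => ?_⟩
    rcases le_or_gt n n₀ with h | h
    · have h2 := Finset.single_le_sum (f := fun i : ℕ => |Z i + δ * i|)
        (fun _ _ => abs_nonneg _) (Finset.mem_range.2 (Nat.lt_succ_of_le h))
      have : 0 ≤ ε * (n : ℝ) := by positivity
      linarith
    · have hn : (0 : ℝ) < n := by exact_mod_cast (Nat.zero_le _).trans_lt h
      have h2 := hn₀ n h.le
      rw [Real.dist_eq, show Z n / n - -δ = (Z n + δ * n) / n by field_simp; ring, abs_div,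
        abs_of_pos hn, div_lt_iff₀ hn] at h2
      have : 0 ≤ ∑ i ∈ Finset.range (n₀ + 1), |Z i + δ * i| :=
        Finset.sum_nonneg fun _ _ => abs_nonneg _
      linarith
  rw [Metric.tendsto_atTop]
  intro ε hε
  obtain ⟨K, hK0, hK⟩ := key (δ * ε / 4) (by positivity)
  obtain ⟨n₁, hn₁⟩ := exists_nat_gt (4 * K / (δ * ε))
  refine ⟨n₁ + 1, fun n hn => ?_⟩
  have hnpos : (0 : ℝ) < n := by exact_mod_cast (Nat.succ_pos _).trans_le hn
  have hnK : 4 * K < n * (δ * ε) := by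
    have h2 : (n₁ : ℝ) < n := by exact_mod_cast hn
    have := hn₁.trans h2
    rwa [div_lt_iff₀ (by positivity)] at this
  have hln : (l n : ℝ) ≤ n := by exact_mod_cast hl n
  have h1 := (abs_le.1 (hK n)).2
  have h2 := (abs_le.1 (hK (l n))).1
  have h3 := hW n
  rw [hWZ n] at h3
  have h4 : δ * ε / 4 * (l n : ℝ) ≤ δ * ε / 4 * n := by gcongr
  have h5 : δ * (n - l n) < δ * (ε * n) := by nlinarith
  have h6 := lt_of_mul_lt_mul_left h5 hδ.le
  rw [Real.dist_eq, abs_sub_comm, show (1 : ℝ) - l n / n = (n - l n) / n by field_simp,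
    abs_of_nonneg (div_nonneg (by linarith) hnpos.le), div_lt_iff₀ hnpos]
  exact h6

/-- The average of the waiting times along a path on which the martingales attached to the
queue are negligible. -/
lemma tendsto_lindley_average {S T : ℕ → ℝ} {lam s σ : ℝ} (hlam : 0 < lam)
    (hρ : lam * s < 1) (hS : ∀ i, 0 ≤ S i)
    (hSavg : Tendsto (fun n : ℕ => (∑ i ∈ Finset.range n, S i) / n) atTop (𝓝 s))
    (hS2avg : Tendsto (fun n : ℕ => (∑ i ∈ Finset.range n, S i ^ 2) / n) atTop (𝓝 σ))
    (hTavg : Tendsto (fun n : ℕ => (∑ i ∈ Finset.range n, T (i + 1)) / n) atTop (𝓝 (1 / lam)))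
    (hM : Tendsto (fun n : ℕ => (∑ i ∈ Finset.range n, (lindley S T (i + 1) -
      lam / 2 * ((lindley S T i + S i) ^ 2 - lindley S T (i + 1) ^ 2))) /
        ∑ j ∈ Finset.range (n + 1), (1 + (lindley S T j + S j))) atTop (𝓝 0))
    (hM' : Tendsto (fun n : ℕ => (∑ i ∈ Finset.range n, lindley S T (i + 1) * (S (i + 1) - s)) /
        ∑ j ∈ Finset.range (n + 1), (1 + (lindley S T j + S j))) atTop (𝓝 0)) :
    Tendsto (fun n : ℕ => (∑ i ∈ Finset.range n, lindley S T i) / n) atTop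
        (𝓝 (lam * σ / (2 * (1 - lam * s)))) ∧
      ∃ C : ℝ, ∀ᶠ n : ℕ in atTop,
        ∑ j ∈ Finset.range (n + 1), (1 + (lindley S T j + S j)) ≤ C * n := by
  set W := lindley S T with hWdef
  have hW0 : W 0 = 0 := rfl
  have hWnn : ∀ i, 0 ≤ W i := lindley_nonneg S T
  set A : ℕ → ℝ := fun n => ∑ j ∈ Finset.range (n + 1), (1 + (W j + S j)) with hA
  set M : ℕ → ℝ := fun n => ∑ i ∈ Finset.range n, (W (i + 1) -
    lam / 2 * ((W i + S i) ^ 2 - W (i + 1) ^ 2)) with hMdef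
  set M' : ℕ → ℝ := fun n => ∑ i ∈ Finset.range n, W (i + 1) * (S (i + 1) - s) with hM'def
  set F : ℕ → ℝ := fun n => ∑ i ∈ Finset.range (n + 1), W i with hF
  set B : ℕ → ℝ := fun n => ∑ i ∈ Finset.range n, S i ^ 2 with hB
  set D : ℕ → ℝ := fun n => M n + lam * M' n with hD
  have hAeq : ∀ n : ℕ, A n = (n + 1) + F n + ∑ i ∈ Finset.range (n + 1), S i := by
    intro n
    simp only [hA, hF, Finset.sum_add_distrib]
    simp; ring
  -- The squares `W i ^ 2` telescope in `M`, and `∑ W i * S i` over `i < n` is `s * F n + M' n - W n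
  -- * S n`.
  have energy : ∀ n, (1 - lam * s) * F n =
      lam / 2 * B n + D n - lam / 2 * W n ^ 2 - lam * (W n * S n) := by
    intro n
    induction n with
    | zero => simp [hF, hB, hD, hMdef, hM'def, hW0]
    | succ n ih =>
      have e1 : F (n + 1) = F n + W (n + 1) := Finset.sum_range_succ _ _
      have e2 : B (n + 1) = B n + S n ^ 2 := Finset.sum_range_succ _ _
      have e3 : M (n + 1) = M n + (W (n + 1) - lam / 2 * ((W n + S n) ^ 2 - W (n + 1) ^ 2)) :=
        Finset.sum_range_succ _ _
      have e4 : M' (n + 1) = M' n + W (n + 1) * (S (n + 1) - s) := Finset.sum_range_succ _ _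
      simp only [hD] at ih ⊢
      rw [e1, e2, e3, e4]
      linear_combination ih
  have hρ' : 0 < 1 - lam * s := by linarith
  have upper : ∀ n, (1 - lam * s) * F n ≤ lam / 2 * B n + D n := by
    intro n
    rw [energy n]
    have := mul_nonneg (hWnn n) (hS n)
    have := sq_nonneg (W n)
    nlinarith
  have hFmono : Monotone F := monotone_nat_of_le_succ fun n => by
    simp only [hF]
    rw [Finset.sum_range_succ _ (n + 1)]
    linarith [hWnn (n + 1)]
  have hF0 : ∀ n, 0 ≤ F n := fun n => Finset.sum_nonneg fun i _ => hWnn i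
  have hDA : Tendsto (fun n => D n / A n) atTop (𝓝 0) := by
    have := hM.add (hM'.const_mul lam)
    simp only [mul_zero, add_zero] at this
    refine this.congr fun n => ?_
    simp only [hD]; ring
  have hApos : ∀ n, 0 < A n := fun n => by
    rw [hAeq]
    have := hF0 n
    have : 0 ≤ ∑ i ∈ Finset.range (n + 1), S i := Finset.sum_nonneg fun i _ => hS i
    have : (0 : ℝ) ≤ n := Nat.cast_nonneg n
    linarith
  -- linear growth
  have hlin : ∃ C : ℝ, ∀ᶠ n : ℕ in atTop, A n ≤ C * n := by
    obtain ⟨C₁, hC₁0, hC₁⟩ := sum_range_le_mul_of_tendsto hSavg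
    obtain ⟨C₂, hC₂0, hC₂⟩ := sum_range_le_mul_of_tendsto hS2avg
    set r := 1 - lam * s with hr
    have hev : ∀ᶠ n in atTop, D n / A n ≤ r / 2 := by
      have := hDA.eventually (gt_mem_nhds (show (0 : ℝ) < r / 2 by positivity))
      exact this.mono fun n hn => hn.le
    refine ⟨2 + 2 * C₁ + 2 / r * (lam / 2 * C₂ + r / 2 * (2 + 2 * C₁)), ?_⟩
    filter_upwards [hev, eventually_ge_atTop 1] with n hn hn1
    have hn1' : (1 : ℝ) ≤ n := by exact_mod_cast hn1
    rw [div_le_iff₀ (hApos n)] at hn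
    have h1 : ∑ i ∈ Finset.range (n + 1), S i ≤ C₁ * (2 * n) := by
      refine (hC₁ (n + 1)).trans ?_
      push_cast
      gcongr; linarith
    have h2 : A n ≤ (2 + 2 * C₁) * n + F n := by rw [hAeq]; linarith
    have h3 : F n ≤ 2 / r * (lam / 2 * C₂ + r / 2 * (2 + 2 * C₁)) * n := by
      have h5 : r * F n ≤ lam / 2 * (C₂ * n) + r / 2 * ((2 + 2 * C₁) * n + F n) :=
        calc r * F n ≤ lam / 2 * B n + D n := upper n
          _ ≤ lam / 2 * (C₂ * n) + r / 2 * ((2 + 2 * C₁) * n + F n) := by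
            refine add_le_add (by gcongr; exact hC₂ n) (hn.trans ?_)
            gcongr
      have h6 : 2 / r * (lam / 2 * C₂ + r / 2 * (2 + 2 * C₁)) * n =
        (lam / 2 * (C₂ * n) + r / 2 * ((2 + 2 * C₁) * n)) / (r / 2) := by field_simp
      rw [h6, le_div_iff₀ (by positivity)]
      linarith
    linarith
  refine ⟨?_, hlin⟩
  -- the limit of the right-hand side of the energy identity
  have hDn : Tendsto (fun n : ℕ => D n / n) atTop (𝓝 0) :=
    tendsto_div_natCast_of_le_mul hApos hlin hDA
  set H : ℕ → ℝ := fun n => lam / 2 * B n + D n with hH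
  have hHn : Tendsto (fun n : ℕ => H n / n) atTop (𝓝 (lam / 2 * σ)) := by
    have := (hS2avg.const_mul (lam / 2)).add hDn
    rw [add_zero] at this
    refine this.congr fun n => ?_
    simp only [hH]; ring
  -- the last empty system
  classical
  set l : ℕ → ℕ := fun n => Nat.findGreatest (fun k => W k = 0) n with hl
  have hln : ∀ n, l n ≤ n := fun n => Nat.findGreatest_le n
  have hWl : ∀ n, W (l n) = 0 := fun n =>
    Nat.findGreatest_spec (P := fun k => W k = 0) (Nat.zero_le n) hW0
  set Z : ℕ → ℝ := fun n => ∑ i ∈ Finset.range n, S i - ∑ i ∈ Finset.range n, T (i + 1) with hZ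
  -- After the last zero the maximum in the recursion is never attained by `0`, so `W` follows the
  -- increments of `Z`.
  have hWZ : ∀ n, W n = Z n - Z (l n) := by
    intro n
    induction n with
    | zero => simp [hl, hW0]
    | succ n ih =>
      by_cases h : W (n + 1) = 0
      · have : l (n + 1) = n + 1 := by
          simp only [hl, Nat.findGreatest_succ]; rw [if_pos h]
        rw [this, h]; ring
      · have h1 : l (n + 1) = l n := by
          simp only [hl, Nat.findGreatest_succ]; rw [if_neg h]
        have h2 : W (n + 1) = W n + S n - T (n + 1) := by
          have h3 : W (n + 1) = max (W n + S n - T (n + 1)) 0 := rfl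
          rw [h3] at h ⊢
          rcases max_choice (W n + S n - T (n + 1)) 0 with h4 | h4
          · exact h4
          · exact absurd h4 h
        have h3 : Z (n + 1) = Z n + (S n - T (n + 1)) := by
          simp only [hZ, Finset.sum_range_succ]; ring
        rw [h1, h2, h3]; linarith
  have hZn : Tendsto (fun n : ℕ => Z n / n) atTop (𝓝 (-(1 / lam - s))) := by
    have := hSavg.sub hTavg
    rw [neg_sub]
    refine this.congr fun n => ?_
    simp only [hZ]; ring
  have hδ : 0 < 1 / lam - s := by
    rw [sub_pos, lt_div_iff₀ hlam]; linarith
  have hlim := tendsto_lastZero_div hδ hln hWnn hWZ hZn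
  have hltop : Tendsto l atTop atTop := by
    have h1 : Tendsto (fun n : ℕ => (l n : ℝ) / n * n) atTop atTop :=
      hlim.pos_mul_atTop one_pos tendsto_natCast_atTop_atTop
    rw [← tendsto_natCast_atTop_iff (R := ℝ)]
    refine h1.congr' ?_
    filter_upwards [eventually_ge_atTop 1] with n hn
    have : (n : ℝ) ≠ 0 := by positivity
    field_simp
  have hHl : Tendsto (fun n : ℕ => H (l n) / n) atTop (𝓝 (lam / 2 * σ)) := by
    have h1 := (hHn.comp hltop).mul hlim
    rw [mul_one] at h1
    refine h1.congr' ?_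
    filter_upwards [hltop.eventually_ge_atTop 1] with n hn
    have h2 : (l n : ℝ) ≠ 0 := by positivity
    simp only [Function.comp]
    field_simp
  have hFlim : Tendsto (fun n : ℕ => F n / n) atTop (𝓝 (lam / 2 * σ / (1 - lam * s))) := by
    refine tendsto_of_tendsto_of_tendsto_of_le_of_le (hHl.div_const _) (hHn.div_const _)
      (fun n => ?_) (fun n => ?_)
    · change H (l n) / n / (1 - lam * s) ≤ F n / n
      -- Both boundary terms of the energy identity contain the factor `W (l n) = 0`.
      have h1 : (1 - lam * s) * F (l n) = H (l n) := by rw [energy, hWl]; simp [hH]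
      rw [div_right_comm]
      gcongr
      rw [div_le_iff₀ hρ', ← h1, mul_comm]
      gcongr
      exact hFmono (hln n)
    · change F n / n ≤ H n / n / (1 - lam * s)
      rw [div_right_comm]
      gcongr
      rw [le_div_iff₀ hρ', mul_comm]
      exact upper n
  rw [← tendsto_add_atTop_iff_nat 1]
  have h1 := hFlim.mul (tendsto_natCast_div_add_atTop (𝕜 := ℝ) 1)
  rw [mul_one, show lam / 2 * σ / (1 - lam * s) = lam * σ / (2 * (1 - lam * s)) by
    field_simp] at h1
  refine h1.congr' ?_
  filter_upwards [eventually_ge_atTop 1] with n hn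
  have h2 : (n : ℝ) ≠ 0 := by positivity
  push_cast
  field_simp
  rfl

/-- The average of weighted waiting times, when the martingales attached to the queue are
negligible. -/
lemma tendsto_lindley_weighted_average {S T c : ℕ → ℝ} {m w : ℝ} (hS : ∀ i, 0 ≤ S i)
    (hlim : Tendsto (fun n : ℕ => (∑ i ∈ Finset.range n, lindley S T i) / n) atTop (𝓝 w))
    (hlin : ∃ C : ℝ, ∀ᶠ n : ℕ in atTop,
      ∑ j ∈ Finset.range (n + 1), (1 + (lindley S T j + S j)) ≤ C * n)
    (hM : Tendsto (fun n : ℕ => (∑ i ∈ Finset.range n, lindley S T (i + 1) * (c (i + 1) - m)) /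
        ∑ j ∈ Finset.range (n + 1), (1 + (lindley S T j + S j))) atTop (𝓝 0)) :
    Tendsto (fun n : ℕ => (∑ i ∈ Finset.range n, lindley S T i * c i) / n) atTop
      (𝓝 (m * w)) := by
  have hApos : ∀ n, 0 < ∑ j ∈ Finset.range (n + 1), (1 + (lindley S T j + S j)) := fun n =>
    Finset.sum_pos (fun j _ => by have := lindley_nonneg S T j; have := hS j; linarith)
      ⟨0, Finset.mem_range.2 n.succ_pos⟩
  have hD := tendsto_div_natCast_of_le_mul hApos hlin hM
  rw [← tendsto_add_atTop_iff_nat 1] at hlim ⊢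
  have h1 := (hD.mul (tendsto_natCast_div_add_atTop (𝕜 := ℝ) 1)).add (hlim.const_mul m)
  rw [zero_mul, zero_add] at h1
  refine h1.congr' ?_
  filter_upwards [eventually_ge_atTop 1] with n hn
  have hn' : (n : ℝ) ≠ 0 := by positivity
  have e : ∑ i ∈ Finset.range (n + 1), lindley S T i * c i =
      ∑ i ∈ Finset.range n, lindley S T (i + 1) * (c (i + 1) - m) +
        m * ∑ i ∈ Finset.range (n + 1), lindley S T i := by
    have h0 : lindley S T 0 = 0 := rfl
    rw [Finset.sum_range_succ', Finset.sum_range_succ' (fun i => lindley S T i), h0]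
    simp only [mul_sub, Finset.sum_sub_distrib, zero_mul, add_zero, Finset.mul_sum]
    rw [sub_add_eq_add_sub, ← Finset.sum_add_distrib, ← Finset.sum_sub_distrib]
    exact Finset.sum_congr rfl fun i _ => by ring
  rw [e]
  push_cast
  field_simp

/-! ### A law of large numbers for martingales -/

section Martingale

variable {Ω : Type*} {mΩ : MeasurableSpace Ω} {μ : Measure Ω} [IsProbabilityMeasure μ]

/-- A series of square-integrable martingale differences whose variances have a finite sum
converges almost surely. -/
lemma ae_exists_tendsto_sum_of_condExp_eq_zero {𝒢 : Filtration ℕ mΩ} {d : ℕ → Ω → ℝ} {K : ℝ}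
    (hd : ∀ i, StronglyMeasurable[𝒢 (i + 1)] (d i)) (hL2 : ∀ i, MemLp (d i) 2 μ)
    (hc : ∀ i, μ[d i | 𝒢 i] =ᵐ[μ] 0)
    (hK : ∀ n, ∑ i ∈ Finset.range n, ∫ ω, d i ω ^ 2 ∂μ ≤ K) :
    ∀ᵐ ω ∂μ, ∃ s, Tendsto (fun n => ∑ i ∈ Finset.range n, d i ω) atTop (𝓝 s) := by
  set M : ℕ → Ω → ℝ := fun n => ∑ i ∈ Finset.range n, d i with hM
  have hMs : ∀ n, M (n + 1) = M n + d n := fun n => Finset.sum_range_succ _ _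
  have hadp : StronglyAdapted 𝒢 M := by
    intro n
    refine Finset.stronglyMeasurable_sum _ fun i hi => (hd i).mono (𝒢.mono ?_)
    exact Finset.mem_range.1 hi
  have hM2 : ∀ n, MemLp (M n) 2 μ := fun n => memLp_finsetSum' _ fun i _ => hL2 i
  have hint : ∀ n, Integrable (M n) μ := fun n => (hM2 n).integrable one_le_two
  have hdint : ∀ n, Integrable (d n) μ := fun n => (hL2 n).integrable one_le_two
  have hmart : Martingale M 𝒢 μ := by
    refine martingale_of_condExp_sub_eq_zero_nat hadp hint fun n => ?_
    rw [hMs, add_sub_cancel_left]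
    exact hc n
  -- Orthogonality of increments makes variances add up; the resulting `L²` bound yields the `L¹`
  -- bound required for Doob's convergence theorem.
  have horth : ∀ n, ∫ ω, M n ω * d n ω ∂μ = 0 := by
    intro n
    have hi : Integrable (M n * d n) μ := (hM2 n).integrable_mul (hL2 n)
    have h1 := condExp_mul_of_stronglyMeasurable_left (hadp n) hi (hdint n)
    have h2 : ∫ ω, (M n * d n) ω ∂μ = 0 := by
      rw [← integral_condExp (𝒢.le n)]
      refine integral_eq_zero_of_ae ?_
      filter_upwards [h1, hc n] with ω h1 h2
      rw [h1, Pi.mul_apply, h2]; simp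
    exact h2
  have hsq : ∀ n, ∫ ω, M n ω ^ 2 ∂μ = ∑ i ∈ Finset.range n, ∫ ω, d i ω ^ 2 ∂μ := by
    intro n
    induction n with
    | zero => simp [hM]
    | succ n ih =>
      rw [Finset.sum_range_succ, ← ih, hMs]
      have hi : Integrable (fun ω => M n ω * d n ω) μ := (hM2 n).integrable_mul (hL2 n)
      have e : ∀ ω, (M n + d n) ω ^ 2 = M n ω ^ 2 + 2 * (M n ω * d n ω) + d n ω ^ 2 := by
        intro ω; simp only [Pi.add_apply]; ring
      simp_rw [e]
      have hi' : Integrable (fun ω => M n ω ^ 2 + 2 * (M n ω * d n ω)) μ :=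
        (hM2 n).integrable_sq.add (hi.const_mul 2)
      rw [integral_add hi' (hL2 n).integrable_sq,
        integral_add (hM2 n).integrable_sq (hi.const_mul 2), integral_const_mul, horth]
      ring
  have hbdd : ∀ n, eLpNorm (M n) 1 μ ≤ (Real.toNNReal (1 + K) : ENNReal) := by
    intro n
    rw [eLpNorm_one_eq_lintegral_enorm, ← ofReal_integral_norm_eq_lintegral_enorm (hint n)]
    refine ENNReal.ofReal_le_ofReal ?_
    calc ∫ ω, ‖M n ω‖ ∂μ ≤ ∫ ω, (1 + M n ω ^ 2) ∂μ := by
          refine integral_mono (hint n).norm ((integrable_const 1).add (hM2 n).integrable_sq)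
            fun ω => ?_
          simp only [Real.norm_eq_abs]
          nlinarith [sq_abs (M n ω), sq_nonneg (|M n ω| - 1)]
      _ = 1 + ∫ ω, M n ω ^ 2 ∂μ := by
          rw [integral_add (integrable_const 1) (hM2 n).integrable_sq]; simp
      _ ≤ 1 + K := by rw [hsq]; linarith [hK n]
  filter_upwards [hmart.submartingale.exists_ae_tendsto_of_bdd hbdd] with ω hω
  simpa [hM, Finset.sum_apply] using hω

/-! ### Integrating out an independent variable -/

variable {F α : Type*} [MeasurableSpace F] [MeasurableSpace α]

lemma lintegral_comp_prodMk_of_indepFun {Y : Ω → α} {ξ : Ω → F} {Q : Measure F}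
    [IsProbabilityMeasure Q] (hY : Measurable Y) (hξ : Measurable ξ) (hind : IndepFun Y ξ μ)
    (hlaw : μ.map ξ = Q) {f : α × F → ENNReal} (hf : Measurable f) :
    ∫⁻ ω, f (Y ω, ξ ω) ∂μ = ∫⁻ ω, ∫⁻ z, f (Y ω, z) ∂Q ∂μ := by
  have h := (indepFun_iff_map_prod_eq_prod_map_map hY.aemeasurable hξ.aemeasurable).1 hind
  rw [← lintegral_map (f := f) hf (hY.prodMk hξ), h, lintegral_prod _ hf.aemeasurable, hlaw,
    lintegral_map (f := fun y => ∫⁻ z, f (y, z) ∂Q) hf.lintegral_prod_right' hY]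

lemma integral_comp_prodMk_of_indepFun {Y : Ω → α} {ξ : Ω → F} {Q : Measure F}
    [IsProbabilityMeasure Q] (hY : Measurable Y) (hξ : Measurable ξ) (hind : IndepFun Y ξ μ)
    (hlaw : μ.map ξ = Q) {f : α × F → ℝ} (hf : Measurable f)
    (hint : Integrable (fun ω => f (Y ω, ξ ω)) μ) :
    ∫ ω, f (Y ω, ξ ω) ∂μ = ∫ ω, ∫ z, f (Y ω, z) ∂Q ∂μ := by
  have h := (indepFun_iff_map_prod_eq_prod_map_map hY.aemeasurable hξ.aemeasurable).1 hind
  have hm := hY.prodMk hξ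
  have : IsProbabilityMeasure (μ.map Y) := Measure.isProbabilityMeasure_map hY.aemeasurable
  have hint' : Integrable f ((μ.map Y).prod Q) := by
    rw [← hlaw, ← h, integrable_map_measure hf.aestronglyMeasurable hm.aemeasurable]
    exact hint
  rw [← integral_map (f := f) hm.aemeasurable hf.aestronglyMeasurable, h, hlaw,
    integral_prod _ hint', integral_map (f := fun y => ∫ z, f (y, z) ∂Q) hY.aemeasurable]
  exact (hf.stronglyMeasurable.integral_prod_right').aestronglyMeasurable

/-- To test against `s` in `m`, its indicator is adjoined to `Y`. The pair is still `m`-measurable,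
hence independent of `ξ`, and Fubini integrates `ξ` out first. -/
lemma condExp_comp_eq_zero_of_indep {Ω : Type*} {m mΩ : MeasurableSpace Ω} {μ : Measure Ω}
    [IsProbabilityMeasure μ] (hm : m ≤ mΩ) {Y : Ω → α} {ξ : Ω → F}
    {Q : Measure F} [IsProbabilityMeasure Q] (hY : Measurable[m] Y) (hξ : Measurable ξ)
    (hind : Indep m (MeasurableSpace.comap ξ inferInstance) μ)
    (hlaw : μ.map ξ = Q) {f : α × F → ℝ} (hf : Measurable f)
    (hint : Integrable (fun ω => f (Y ω, ξ ω)) μ) (h0 : ∀ ω, ∫ z, f (Y ω, z) ∂Q = 0) :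
    μ[fun ω => f (Y ω, ξ ω) | m] =ᵐ[μ] 0 := by
  symm
  refine ae_eq_condExp_of_forall_setIntegral_eq hm hint (fun s _ _ => integrableOn_zero)
    (fun s hs _ => ?_) stronglyMeasurable_zero.aestronglyMeasurable
  have hs' : MeasurableSet s := hm s hs
  set g : Ω → ℝ := s.indicator 1 with hg
  have hgm : Measurable[m] g := (@measurable_const ℝ Ω _ m 1).indicator hs
  have hY' : Measurable[m] (fun ω => (g ω, Y ω)) := Measurable.prodMk hgm hY
  have hind' : IndepFun (fun ω => (g ω, Y ω)) ξ μ :=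
    (IndepFun_iff_Indep _ _ _).2 (indep_of_indep_of_le_left hind hY'.comap_le)
  have e : ∀ ω, s.indicator (fun ω => f (Y ω, ξ ω)) ω = g ω * f (Y ω, ξ ω) := by
    intro ω
    by_cases h : ω ∈ s <;> simp [hg, h]
  have hf' : Measurable (fun p : (ℝ × α) × F => p.1.1 * f (p.1.2, p.2)) := by fun_prop
  have key := integral_comp_prodMk_of_indepFun (hY'.mono hm le_rfl) hξ hind' hlaw hf' (by
    simp only
    rw [← funext e]
    exact hint.indicator hs')
  simp only at key
  rw [Pi.zero_def, integral_zero, ← integral_indicator hs', integral_congr_ae (ae_of_all _ e), key]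
  simp_rw [integral_const_mul, h0]
  simp

/-- Partial sums of nonnegative terms increase, so the terms kept form an initial segment, whose
total is at most `c`. -/
lemma sum_ite_partialSum_le {r : ℕ → ℝ} {c : ℝ} (hr : ∀ i, 0 ≤ r i) (hc : 0 ≤ c) (n : ℕ) :
    ∑ i ∈ Finset.range n, (if ∑ j ∈ Finset.range (i + 1), r j ≤ c then r i else 0) ≤ c := by
  induction n with
  | zero => simpa
  | succ n ih =>
    rw [Finset.sum_range_succ]
    split_ifs with h
    · refine le_trans ?_ h
      rw [Finset.sum_range_succ]
      gcongr with i
      split_ifs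
      · exact le_rfl
      · exact hr i
    · linarith

/-- A law of large numbers for sums of `ψ (u i, ξ (i + 1))`, where `u i` depends on the past of the
independent variables `ξ`, normalized by the (random) sums of `1 + u i`. -/
lemma ae_tendsto_sum_div_of_indep {𝒢 : Filtration ℕ mΩ} {ξ : ℕ → Ω → F} {Q : Measure F}
    [IsProbabilityMeasure Q] (hξ : ∀ i, Measurable[𝒢 i] (ξ i))
    (hind : ∀ i, Indep (𝒢 i) (MeasurableSpace.comap (ξ (i + 1)) inferInstance) μ)
    (hlaw : ∀ i, μ.map (ξ i) = Q) {u : ℕ → Ω → ℝ} (hu : ∀ i, Measurable[𝒢 i] (u i))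
    (hu0 : ∀ i ω, 0 ≤ u i ω) {ψ : ℝ × F → ℝ} (hψ : Measurable ψ)
    (h0 : ∀ v, 0 ≤ v → ∫ z, ψ (v, z) ∂Q = 0) {C : ℝ} (hC : 0 ≤ C)
    (h2 : ∀ v, 0 ≤ v → ∫⁻ z, ENNReal.ofReal (ψ (v, z) ^ 2) ∂Q ≤ ENNReal.ofReal (C * (1 + v) ^ 2))
    (hsum : ∀ᵐ ω ∂μ, ∃ c : ℝ, ∀ n, ∑ i ∈ Finset.range n,
      ((1 + u i ω) / ∑ j ∈ Finset.range (i + 1), (1 + u j ω)) ^ 2 ≤ c) :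
    ∀ᵐ ω ∂μ, Tendsto (fun n : ℕ => (∑ i ∈ Finset.range n, ψ (u i ω, ξ (i + 1) ω)) /
      ∑ j ∈ Finset.range (n + 1), (1 + u j ω)) atTop (𝓝 0) := by
  set A : ℕ → Ω → ℝ := fun n ω => ∑ j ∈ Finset.range (n + 1), (1 + u j ω) with hA
  have hAge : ∀ (n : ℕ) ω, (n + 1 : ℝ) ≤ A n ω := by
    intro n ω
    have := Finset.sum_le_sum (s := Finset.range (n + 1)) (f := fun _ => (1 : ℝ))
      (g := fun j => 1 + u j ω) fun j _ => by linarith [hu0 j ω]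
    simpa using this
  have hApos : ∀ n ω, 0 < A n ω := fun n ω => by
    have := hAge n ω; have : (0 : ℝ) ≤ n := Nat.cast_nonneg n; linarith
  have hAm : ∀ n, Measurable[𝒢 n] (A n) := fun n =>
    Finset.measurable_fun_sum _ fun j hj => (measurable_const.add
      ((hu j).mono (𝒢.mono (by have := Finset.mem_range.1 hj; omega)) le_rfl))
  set r : ℕ → Ω → ℝ := fun i ω => ((1 + u i ω) / A i ω) ^ 2 with hr
  have hrm : ∀ i, Measurable[𝒢 i] (r i) := fun i =>
    ((measurable_const.add (hu i)).div (hAm i)).pow_const 2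
  have hr0 : ∀ i ω, 0 ≤ r i ω := fun i ω => sq_nonneg _
  set R : ℕ → Ω → ℝ := fun i ω => ∑ j ∈ Finset.range (i + 1), r j ω with hR
  have hRm : ∀ i, Measurable[𝒢 i] (R i) := fun i =>
    Finset.measurable_fun_sum _ fun j hj =>
      (hrm j).mono (𝒢.mono (by have := Finset.mem_range.1 hj; omega)) le_rfl
  -- The pathwise bound on `R` is random, so the terms are cut off once `R` exceeds `c`. The cutoff
  -- at `i` is `𝒢 i`-measurable, so martingale differences remain, with variances summing to at most
  -- `C * c`.
  have key : ∀ c : ℕ, ∀ᵐ ω ∂μ, ∃ s, Tendsto (fun n => ∑ i ∈ Finset.range n,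
      (if R i ω ≤ c then 1 / A i ω else 0) * ψ (u i ω, ξ (i + 1) ω)) atTop (𝓝 s) := by
    intro c
    set a : ℕ → Ω → ℝ := fun i ω => if R i ω ≤ c then 1 / A i ω else 0 with ha
    have ham : ∀ i, Measurable[𝒢 i] (a i) := fun i =>
      Measurable.ite (measurableSet_le (hRm i) measurable_const)
        (measurable_const.div (hAm i)) measurable_const
    have hYm : ∀ i, Measurable[𝒢 i] (fun ω => (a i ω, u i ω)) := fun i => (ham i).prodMk (hu i)
    have hξm : ∀ i, Measurable (ξ i) := fun i => (hξ i).mono (𝒢.le i) le_rfl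
    have hfm : Measurable (fun p : (ℝ × ℝ) × F => p.1.1 * ψ (p.1.2, p.2)) := by fun_prop
    have hdm : ∀ i, Measurable[𝒢 (i + 1)] (fun ω => a i ω * ψ (u i ω, ξ (i + 1) ω)) := fun i =>
      hfm.comp (((hYm i).mono (𝒢.mono i.le_succ) le_rfl).prodMk (hξ (i + 1)))
    have hdm' : ∀ i, Measurable (fun ω => a i ω * ψ (u i ω, ξ (i + 1) ω)) := fun i =>
      (hdm i).mono (𝒢.le _) le_rfl
    have hif : ∀ i, IndepFun (fun ω => (a i ω, u i ω)) (ξ (i + 1)) μ := fun i =>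
      (IndepFun_iff_Indep _ _ _).2 (indep_of_indep_of_le_left (hind i) (hYm i).comap_le)
    have hcr : ∀ i ω, a i ω ^ 2 * (1 + u i ω) ^ 2 = if R i ω ≤ c then r i ω else 0 := by
      intro i ω
      simp only [ha, hr]
      split_ifs <;> ring
    have hr1 : ∀ i ω, r i ω ≤ 1 := by
      intro i ω
      simp only [hr]
      refine pow_le_one₀ (div_nonneg (by linarith [hu0 i ω]) (hApos i ω).le) ?_
      rw [div_le_one (hApos i ω)]
      exact Finset.single_le_sum (f := fun j => 1 + u j ω) (fun j _ => by linarith [hu0 j ω])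
        (Finset.self_mem_range_succ i)
    have hgm : ∀ i, Measurable (fun ω => if R i ω ≤ c then r i ω else 0) := fun i =>
      Measurable.ite (measurableSet_le ((hRm i).mono (𝒢.le i) le_rfl) measurable_const)
        ((hrm i).mono (𝒢.le i) le_rfl) measurable_const
    have hg0 : ∀ i ω, 0 ≤ (if R i ω ≤ c then r i ω else 0) := by
      intro i ω; split_ifs
      · exact hr0 i ω
      · exact le_rfl
    have hgint : ∀ i, Integrable (fun ω => if R i ω ≤ c then r i ω else 0) μ := by
      intro i
      refine Integrable.of_bound (hgm i).aestronglyMeasurable 1 (ae_of_all _ fun ω => ?_)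
      rw [Real.norm_of_nonneg (hg0 i ω)]
      split_ifs
      · exact hr1 i ω
      · exact zero_le_one
    have hlint : ∀ i, ∫⁻ ω, ENNReal.ofReal ((a i ω * ψ (u i ω, ξ (i + 1) ω)) ^ 2) ∂μ ≤
        ENNReal.ofReal (C * ∫ ω, (if R i ω ≤ c then r i ω else 0) ∂μ) := by
      intro i
      have h1 := lintegral_comp_prodMk_of_indepFun ((hYm i).mono (𝒢.le i) le_rfl) (hξm (i + 1))
        (hif i) (hlaw (i + 1))
        (f := fun p => ENNReal.ofReal ((p.1.1 * ψ (p.1.2, p.2)) ^ 2))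
        (by fun_prop)
      simp only at h1
      rw [h1, ← integral_const_mul, ofReal_integral_eq_lintegral_ofReal
        ((hgint i).const_mul C) (ae_of_all _ fun ω => mul_nonneg hC (hg0 i ω))]
      refine lintegral_mono fun ω => ?_
      simp_rw [mul_pow, ENNReal.ofReal_mul (sq_nonneg (a i ω))]
      rw [lintegral_const_mul _ (by fun_prop)]
      refine (mul_le_mul_right (h2 (u i ω) (hu0 i ω)) _).trans ?_
      rw [← ENNReal.ofReal_mul (sq_nonneg _), ← hcr]
      exact ENNReal.ofReal_le_ofReal (le_of_eq (by ring))
    have hsqint : ∀ i, Integrable (fun ω => (a i ω * ψ (u i ω, ξ (i + 1) ω)) ^ 2) μ := by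
      intro i
      refine ⟨((hdm' i).pow_const 2).aestronglyMeasurable, ?_⟩
      rw [hasFiniteIntegral_iff_ofReal (ae_of_all _ fun ω => sq_nonneg _)]
      exact (hlint i).trans_lt ENNReal.ofReal_lt_top
    have hL2 : ∀ i, MemLp (fun ω => a i ω * ψ (u i ω, ξ (i + 1) ω)) 2 μ := fun i =>
      (memLp_two_iff_integrable_sq (hdm' i).aestronglyMeasurable).2 (hsqint i)
    refine ae_exists_tendsto_sum_of_condExp_eq_zero (𝒢 := 𝒢)
      (d := fun i ω => a i ω * ψ (u i ω, ξ (i + 1) ω)) (K := C * c)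
      (fun i => (hdm i).stronglyMeasurable) hL2 (fun i => ?_) (fun n => ?_)
    · refine condExp_comp_eq_zero_of_indep (𝒢.le i) (hYm i) (hξm (i + 1)) (hind i) (hlaw (i + 1))
        hfm ((hL2 i).integrable one_le_two) fun ω => ?_
      simp only [integral_const_mul, h0 (u i ω) (hu0 i ω), mul_zero]
    · have h3 : ∀ i, ∫ ω, (a i ω * ψ (u i ω, ξ (i + 1) ω)) ^ 2 ∂μ ≤
          C * ∫ ω, (if R i ω ≤ c then r i ω else 0) ∂μ := by
        intro i
        rw [integral_eq_lintegral_of_nonneg_ae (ae_of_all _ fun ω => sq_nonneg _)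
          ((hdm' i).pow_const 2).aestronglyMeasurable]
        exact ENNReal.toReal_le_of_le_ofReal
          (mul_nonneg hC (integral_nonneg fun ω => hg0 i ω)) (hlint i)
      refine (Finset.sum_le_sum fun i _ => h3 i).trans ?_
      rw [← Finset.mul_sum, ← integral_finsetSum _ fun i _ => hgint i]
      gcongr
      calc _ ≤ ∫ _, (c : ℝ) ∂μ := integral_mono (integrable_finsetSum _ fun i _ => hgint i)
            (integrable_const _)
            (fun ω => sum_ite_partialSum_le (hr0 · ω) (Nat.cast_nonneg c) n)
        _ = c := by simp
  filter_upwards [ae_all_iff.2 key, hsum] with ω hω ⟨c, hc⟩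
  -- On this path `R` never exceeds `k`, so the cutoff at level `k` is inactive and Kronecker's
  -- lemma applies to the full series.
  obtain ⟨k, hk⟩ := exists_nat_ge c
  obtain ⟨s, hs⟩ := hω k
  have hAmono : Monotone (fun n => A n ω) := monotone_nat_of_le_succ fun n => by
    simp only [hA]
    rw [Finset.sum_range_succ _ (n + 1)]
    linarith [hu0 (n + 1) ω]
  have hAtop : Tendsto (fun n => A n ω) atTop atTop :=
    tendsto_atTop_mono (fun n => (by linarith [hAge n ω] : (n : ℝ) ≤ A n ω))
      tendsto_natCast_atTop_atTop
  refine (tendsto_sum_mul_div_of_tendsto_sum hAmono (hApos · ω) hAtop hs).congr fun n => ?_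
  congr 1
  refine Finset.sum_congr rfl fun i _ => ?_
  rw [if_pos ((hc (i + 1)).trans hk)]
  have := (hApos i ω).ne'
  field_simp

end Martingale

/-! ### The exponential distribution -/

lemma expMeasure_eq_withDensity (r : ℝ) : expMeasure r =
    (volume.restrict (Set.Ioi 0)).withDensity
      (fun x => ENNReal.ofReal (r * Real.exp (-(r * x)))) := by
  rw [Measure.restrict_congr_set Ioi_ae_eq_Ici, ← withDensity_indicator measurableSet_Ici]
  change volume.withDensity (exponentialPDF r) = _
  congr 1
  funext x
  rw [exponentialPDF_eq]
  by_cases hx : 0 ≤ x <;> simp [hx, Set.indicator]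

lemma measurable_expDensity (r : ℝ) :
    Measurable (fun x : ℝ => ENNReal.ofReal (r * Real.exp (-(r * x)))) := by fun_prop

lemma lintegral_expMeasure (r : ℝ) {f : ℝ → ENNReal} (hf : Measurable f) :
    ∫⁻ x, f x ∂expMeasure r =
      ∫⁻ x in Set.Ioi 0, ENNReal.ofReal (r * Real.exp (-(r * x))) * f x := by
  rw [expMeasure_eq_withDensity, lintegral_withDensity_eq_lintegral_mul _
    (measurable_expDensity r) hf]
  rfl

lemma integral_expMeasure {r : ℝ} (hr : 0 < r) (f : ℝ → ℝ) :
    ∫ x, f x ∂expMeasure r = ∫ x in Set.Ioi 0, r * Real.exp (-(r * x)) * f x := by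
  rw [expMeasure_eq_withDensity, integral_withDensity_eq_integral_toReal_smul
    (measurable_expDensity r) (by simp)]
  refine integral_congr_ae (ae_of_all _ fun x => ?_)
  simp only [smul_eq_mul]
  rw [ENNReal.toReal_ofReal (by positivity)]

lemma ae_pos_expMeasure (r : ℝ) : ∀ᵐ x ∂expMeasure r, 0 < x := by
  rw [expMeasure_eq_withDensity]
  exact (withDensity_absolutelyContinuous _ _).ae_le (ae_restrict_mem measurableSet_Ioi)

/-- With `b` the total rate of competing streams, `exp (-(b x))` is the probability that none of
them has an arrival by time `x`; tilting by it produces the winning probability `a / (a + b)` and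
the law of the minimum. -/
lemma lintegral_exp_neg_mul_expMeasure {a b : ℝ} (ha : 0 < a) (hb : 0 ≤ b) {f : ℝ → ENNReal}
    (hf : Measurable f) :
    ∫⁻ x, ENNReal.ofReal (Real.exp (-(b * x))) * f x ∂expMeasure a =
      ENNReal.ofReal (a / (a + b)) * ∫⁻ x, f x ∂expMeasure (a + b) := by
  rw [lintegral_expMeasure _ (by fun_prop), lintegral_expMeasure _ hf,
    ← lintegral_const_mul _ (by fun_prop)]
  refine lintegral_congr fun x => ?_
  rw [← mul_assoc, ← mul_assoc, ← ENNReal.ofReal_mul (by positivity),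
    ← ENNReal.ofReal_mul (by positivity)]
  congr 2
  have : a + b ≠ 0 := by positivity
  rw [← mul_assoc, div_mul_cancel₀ _ this, mul_assoc, ← Real.exp_add]
  ring_nf

/-- The exponential distribution is memoryless. -/
lemma setLIntegral_Ioi_expMeasure {r t : ℝ} (ht : 0 ≤ t) {f : ℝ → ENNReal}
    (hf : Measurable f) :
    ∫⁻ x in Set.Ioi t, f (x - t) ∂expMeasure r =
      ENNReal.ofReal (Real.exp (-(r * t))) * ∫⁻ x, f x ∂expMeasure r := by
  rw [← lintegral_indicator measurableSet_Ioi,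
    lintegral_expMeasure _ (Measurable.indicator (by fun_prop) measurableSet_Ioi),
    lintegral_expMeasure _ hf, ← lintegral_const_mul _ (by fun_prop),
    ← lintegral_indicator measurableSet_Ioi, ← lintegral_indicator measurableSet_Ioi,
    ← lintegral_add_right_eq_self _ t]
  refine lintegral_congr fun x => ?_
  by_cases hx : 0 < x
  · have h1 : 0 < x + t := by linarith
    have h2 : t < x + t := by linarith
    simp only [Set.indicator, Set.mem_Ioi, hx, h1, h2, if_true, add_sub_cancel_right]
    rw [← mul_assoc, ← ENNReal.ofReal_mul (by positivity)]
    congr 2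
    rw [mul_left_comm, ← Real.exp_add]
    ring_nf
  · have h2 : ¬ t < x + t := by linarith
    simp only [Set.indicator, Set.mem_Ioi, hx, h2, if_false]
    simp

lemma integrable_expMeasure_iff {r : ℝ} (hr : 0 < r) {f : ℝ → ℝ} :
    Integrable f (expMeasure r) ↔
      IntegrableOn (fun x => r * Real.exp (-(r * x)) * f x) (Set.Ioi 0) := by
  rw [expMeasure_eq_withDensity, integrable_withDensity_iff_integrable_smul'
    (measurable_expDensity r) (by simp)]
  unfold IntegrableOn
  refine integrable_congr (ae_of_all _ fun x => ?_)
  simp only [smul_eq_mul]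
  rw [ENNReal.toReal_ofReal (by positivity)]

lemma integrable_pow_expMeasure {r : ℝ} (hr : 0 < r) (k : ℕ) :
    Integrable (fun x => x ^ k) (expMeasure r) := by
  rw [integrable_expMeasure_iff hr]
  have h := (integrableOn_rpow_mul_exp_neg_mul_rpow (p := 1) (s := k) (b := r)
    (by have : (0 : ℝ) ≤ k := Nat.cast_nonneg k; linarith) one_pos hr).const_mul r
  refine IntegrableOn.congr_fun h (fun x _ => ?_) measurableSet_Ioi
  simp only [Real.rpow_natCast, Real.rpow_one]
  ring_nf

lemma integral_id_expMeasure {r : ℝ} (hr : 0 < r) : ∫ x, x ∂expMeasure r = 1 / r := by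
  rw [integral_expMeasure hr]
  have h := Real.integral_rpow_mul_exp_neg_mul_Ioi (a := 2) two_pos hr
  have e : ∀ x ∈ Set.Ioi (0 : ℝ), r * Real.exp (-(r * x)) * x =
      r * (x ^ ((2 : ℝ) - 1) * Real.exp (-(r * x))) := by
    intro x _
    rw [show (2 : ℝ) - 1 = 1 by norm_num, Real.rpow_one]; ring
  rw [setIntegral_congr_fun measurableSet_Ioi e, integral_const_mul, h]
  have : Real.Gamma 2 = 1 := Real.Gamma_two
  rw [this, show (2 : ℝ) = (2 : ℕ) by norm_num, Real.rpow_natCast]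
  field_simp

/-- The workload left after an exponential time, against the area under the workload. -/
lemma integral_workload_expMeasure {r u : ℝ} (hr : 0 < r) (hu : 0 ≤ u) :
    ∫ x, (max (u - x) 0 - r / 2 * (u ^ 2 - max (u - x) 0 ^ 2)) ∂expMeasure r = 0 := by
  have := isProbabilityMeasure_expMeasure hr
  -- The integrand is the derivative of `-(r / 2) (u - x) ^ 2 exp (-(r x))`, which vanishes at `x =
  -- u`.
  have hFTC : ∫ x in (0 : ℝ)..u, r * Real.exp (-(r * x)) * ((u - x) + r / 2 * (u - x) ^ 2) =
      r / 2 * u ^ 2 := by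
    rw [intervalIntegral.integral_eq_sub_of_hasDerivAt
      (f := fun x => -(r / 2) * ((u - x) ^ 2 * Real.exp (-(r * x))))]
    · simp
    · intro x _
      have h1 : HasDerivAt (fun x : ℝ => (u - x) ^ 2) (2 * (u - x) * (-1)) x := by
        have := ((hasDerivAt_id x).const_sub u).pow 2
        simp only [Nat.cast_ofNat, Nat.add_one_sub_one, pow_one] at this
        exact this
      have h2 : HasDerivAt (fun x : ℝ => Real.exp (-(r * x)))
          (Real.exp (-(r * x)) * (-(r * 1))) x :=
        (((hasDerivAt_id x).const_mul r).neg).exp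
      convert! (h1.mul h2).const_mul (-(r / 2)) using 1
      ring
    · exact (Continuous.intervalIntegrable (by fun_prop) _ _)
  have hbase : ∫ x, (max (u - x) 0 + r / 2 * max (u - x) 0 ^ 2) ∂expMeasure r = r / 2 * u ^ 2 := by
    rw [integral_expMeasure hr, ← hFTC, intervalIntegral.integral_of_le hu,
      setIntegral_eq_of_subset_of_forall_sdiff_eq_zero (s := Set.Ioc 0 u) measurableSet_Ioi
        Set.Ioc_subset_Ioi_self]
    · refine setIntegral_congr_fun measurableSet_Ioc fun x hx => ?_
      rw [max_eq_left (by linarith [hx.2])]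
    · intro x hx
      have : u ≤ x := by
        by_contra h
        exact hx.2 ⟨hx.1, (not_le.1 h).le⟩
      rw [max_eq_right (by linarith)]
      simp
  have hint : Integrable (fun x => max (u - x) 0 + r / 2 * max (u - x) 0 ^ 2) (expMeasure r) := by
    refine Integrable.of_bound (C := u + r / 2 * u ^ 2) (by fun_prop) ?_
    filter_upwards [ae_pos_expMeasure r] with x hx
    have h1 : max (u - x) 0 ≤ u := max_le (by linarith) hu
    have h0 : 0 ≤ max (u - x) 0 := le_max_right _ _
    rw [Real.norm_of_nonneg (by positivity)]
    gcongr
  have e : ∀ x, max (u - x) 0 - r / 2 * (u ^ 2 - max (u - x) 0 ^ 2) =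
      (max (u - x) 0 + r / 2 * max (u - x) 0 ^ 2) - r / 2 * u ^ 2 := fun x => by ring
  simp_rw [e]
  rw [integral_sub hint (integrable_const _), hbase]
  simp

/-! ### Sequences of independent variables -/

section Sequences

variable {α : Type*} [MeasurableSpace α]

/-- A box over an arbitrary finite index set becomes one over an initial segment when padded with
`Set.univ`. Initial segments suit induction on the length. -/
lemma eq_infinitePi_of_pi_range {η : ℕ → Measure α} [∀ i, IsProbabilityMeasure (η i)]
    {ν : Measure (ℕ → α)}
    (h : ∀ (n : ℕ) (t : ℕ → Set α), (∀ i, MeasurableSet (t i)) →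
      ν (Set.pi (Finset.range n) t) = ∏ i ∈ Finset.range n, η i (t i)) :
    ν = Measure.infinitePi η := by
  classical
  refine Measure.eq_infinitePi _ fun s t ht => ?_
  obtain ⟨n, hn⟩ := s.exists_nat_subset_range
  set t' : ℕ → Set α := fun i => if i ∈ s then t i else Set.univ with ht'
  have e1 : Set.pi (s : Set ℕ) t = Set.pi (Finset.range n) t' := by
    ext f
    simp only [Set.mem_pi, ht']
    refine ⟨fun hf i _ => ?_, fun hf i hi => ?_⟩
    · split_ifs with hi
      · exact hf i hi
      · trivial
    · have hi' : i ∈ s := hi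
      have := hf i (hn hi)
      rwa [if_pos hi'] at this
  have ht'm : ∀ i, MeasurableSet (t' i) := by
    intro i; simp only [ht']; split_ifs
    · exact ht i
    · exact .univ
  rw [e1, h n t' ht'm, ← Finset.prod_subset hn]
  · exact Finset.prod_congr rfl fun i hi => by simp [ht', hi]
  · intro i _ hi
    simp [ht', hi]

/-- Put an element in front of a sequence. -/
def streamCons (p : α × (ℕ → α)) : ℕ → α
  | 0 => p.1
  | j + 1 => p.2 j

lemma measurable_streamCons : Measurable (streamCons (α := α)) := by
  refine measurable_pi_lambda _ fun j => ?_
  cases j with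
  | zero => exact measurable_fst
  | succ j => exact (measurable_pi_apply j).comp measurable_snd

lemma map_streamCons (η : Measure α) [IsProbabilityMeasure η] :
    (η.prod (Measure.infinitePi fun _ : ℕ => η)).map streamCons =
      Measure.infinitePi fun _ : ℕ => η := by
  refine eq_infinitePi_of_pi_range fun n t ht => ?_
  rw [Measure.map_apply measurable_streamCons
    (MeasurableSet.pi (Finset.countable_toSet _) fun i _ => ht i)]
  cases n with
  | zero => simp
  | succ n =>
    have e : streamCons ⁻¹' (Set.pi (Finset.range (n + 1)) t) =
        t 0 ×ˢ Set.pi (Finset.range n) (fun j => t (j + 1)) := by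
      ext ⟨z, f⟩
      simp only [Set.mem_preimage, Set.mem_pi, Set.mem_prod, Finset.coe_range, Set.mem_Iio]
      refine ⟨fun h => ⟨h 0 n.succ_pos, fun j hj => h (j + 1) (by omega)⟩, fun h j hj => ?_⟩
      cases j with
      | zero => exact h.1
      | succ j => exact h.2 j (by omega)
    rw [e, Measure.prod_prod, Measure.infinitePi_pi _ fun i _ => ht (i + 1),
      Finset.prod_range_succ', mul_comm]

lemma lintegral_infinitePi_streamCons (η : Measure α) [IsProbabilityMeasure η]
    {f : (ℕ → α) → ENNReal} (hf : Measurable f) :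
    ∫⁻ e, f e ∂(Measure.infinitePi fun _ : ℕ => η) =
      ∫⁻ z, ∫⁻ e, f (streamCons (z, e)) ∂(Measure.infinitePi fun _ : ℕ => η) ∂η := by
  conv_lhs => rw [← map_streamCons η]
  rw [lintegral_map hf measurable_streamCons,
    lintegral_prod (fun p => f (streamCons p)) (hf.comp measurable_streamCons).aemeasurable]

/-- If a random element has the same law after a step, and is then independent of what was
observed at that step, the observations of successive steps are independent and identically
distributed. -/
lemma map_iterate_eq_infinitePi {E F : Type*} [MeasurableSpace E] [MeasurableSpace F]
    {P : Measure E} [IsProbabilityMeasure P] {Q : Measure F} [IsProbabilityMeasure Q]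
    {ξ : E → F} {θ : E → E} (hξ : Measurable ξ) (hθ : Measurable θ)
    (h : P.map (fun e => (ξ e, θ e)) = Q.prod P) :
    P.map (fun e i => ξ (θ^[i] e)) = Measure.infinitePi fun _ : ℕ => Q := by
  have hm : Measurable (fun e (i : ℕ) => ξ (θ^[i] e)) :=
    measurable_pi_lambda _ fun i => hξ.comp (hθ.iterate i)
  have key : ∀ (n : ℕ) (t : ℕ → Set F), (∀ i, MeasurableSet (t i)) →
      P ((fun e (i : ℕ) => ξ (θ^[i] e)) ⁻¹' Set.pi (Finset.range n) t) =
        ∏ i ∈ Finset.range n, Q (t i) := by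
    intro n
    induction n with
    | zero => intro t _; simp
    | succ n ih =>
      intro t ht
      have e : (fun e (i : ℕ) => ξ (θ^[i] e)) ⁻¹' Set.pi (Finset.range (n + 1)) t =
          (fun e => (ξ e, θ e)) ⁻¹' (t 0 ×ˢ ((fun e (i : ℕ) => ξ (θ^[i] e)) ⁻¹'
            Set.pi (Finset.range n) fun j => t (j + 1))) := by
        ext x
        simp only [Set.mem_preimage, Set.mem_pi, Set.mem_prod, Finset.coe_range, Set.mem_Iio]
        refine ⟨fun h => ⟨h 0 n.succ_pos, fun j hj => h (j + 1) (by omega)⟩, fun h j hj => ?_⟩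
        cases j with
        | zero => exact h.1
        | succ j => exact h.2 j (by omega)
      have hms : MeasurableSet ((fun e (i : ℕ) => ξ (θ^[i] e)) ⁻¹'
            Set.pi (Finset.range n) fun j => t (j + 1)) :=
        hm (MeasurableSet.pi (Finset.countable_toSet _) fun i _ => ht (i + 1))
      rw [e, ← Measure.map_apply (hξ.prodMk hθ) ((ht 0).prod hms), h, Measure.prod_prod,
        ih _ fun i => ht (i + 1), Finset.prod_range_succ', mul_comm]
  refine eq_infinitePi_of_pi_range fun n t ht => ?_
  rw [Measure.map_apply hm (MeasurableSet.pi (Finset.countable_toSet _) fun i _ => ht i)]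
  exact key n t ht

end Sequences

/-! ### Superposition of the arrival streams

A stream is a sequence of pairs (time until the arrival, service time), the first time being counted
from the present. -/

/-- The stream seen `t` time units later, before its next arrival. -/
def advance (t : ℝ) (f : ℕ → ℝ × ℝ) : ℕ → ℝ × ℝ :=
  streamCons (((f 0).1 - t, (f 0).2), fun j => f (j + 1))

lemma measurable_advance : Measurable (fun p : ℝ × (ℕ → ℝ × ℝ) => advance p.1 p.2) := by
  unfold advance
  exact measurable_streamCons.comp (by fun_prop)

/-! ### Memorylessness of Poisson streams -/

section Laws

/-- The law of a Poisson stream of rate `r` with independent service times of law `ν`. -/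
noncomputable def streamLaw (r : ℝ) [IsProbabilityMeasure (expMeasure r)] (ν : Measure ℝ)
    [IsProbabilityMeasure ν] : Measure (ℕ → ℝ × ℝ) :=
  Measure.infinitePi fun _ => (expMeasure r).prod ν

instance (r : ℝ) [IsProbabilityMeasure (expMeasure r)] (ν : Measure ℝ)
    [IsProbabilityMeasure ν] : IsProbabilityMeasure (streamLaw r ν) := by
  unfold streamLaw; infer_instance

lemma lintegral_streamLaw (r : ℝ) [IsProbabilityMeasure (expMeasure r)] (ν : Measure ℝ)
    [IsProbabilityMeasure ν] {f : (ℕ → ℝ × ℝ) → ENNReal} (hf : Measurable f) :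
    ∫⁻ e, f e ∂streamLaw r ν = ∫⁻ x, ∫⁻ s, ∫⁻ e, f (streamCons ((x, s), e)) ∂streamLaw r ν ∂ν
      ∂expMeasure r := by
  have hm : Measurable (fun z : ℝ × ℝ => ∫⁻ e, f (streamCons (z, e)) ∂streamLaw r ν) :=
    (hf.comp measurable_streamCons).lintegral_prod_right'
  unfold streamLaw at *
  rw [lintegral_infinitePi_streamCons _ hf, lintegral_prod _ hm.aemeasurable]

/-- Only the first interarrival time feels the passage of time, so memorylessness of one exponential
variable carries over to the whole stream. -/
lemma setLIntegral_streamLaw_advance {r t : ℝ} [IsProbabilityMeasure (expMeasure r)]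
    (ν : Measure ℝ) [IsProbabilityMeasure ν] (ht : 0 ≤ t)
    {f : (ℕ → ℝ × ℝ) → ENNReal} (hf : Measurable f) :
    ∫⁻ e in {e | t < (e 0).1}, f (advance t e) ∂streamLaw r ν =
      ENNReal.ofReal (Real.exp (-(r * t))) * ∫⁻ e, f e ∂streamLaw r ν := by
  have hs : MeasurableSet {e : ℕ → ℝ × ℝ | t < (e 0).1} :=
    measurableSet_lt measurable_const (by fun_prop)
  have hadv : Measurable (advance t) := measurable_advance.comp measurable_prodMk_left
  have hfa : Measurable (fun e => f (advance t e)) := hf.comp hadv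
  rw [← lintegral_indicator hs, lintegral_streamLaw r ν (hfa.indicator hs),
    lintegral_streamLaw r ν hf]
  have hm : Measurable (fun x : ℝ => ∫⁻ s, ∫⁻ e, f (streamCons ((x, s), e)) ∂streamLaw r ν ∂ν) := by
    have h1 : Measurable (fun z : ℝ × ℝ => ∫⁻ e, f (streamCons (z, e)) ∂streamLaw r ν) :=
      (hf.comp measurable_streamCons).lintegral_prod_right'
    exact h1.lintegral_prod_right'
  rw [← setLIntegral_Ioi_expMeasure ht hm, ← lintegral_indicator measurableSet_Ioi]
  refine lintegral_congr fun x => ?_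
  by_cases hx : t < x
  · have e : ∀ s e, streamCons ((x, s), e) ∈ {e : ℕ → ℝ × ℝ | t < (e 0).1} := fun s e => hx
    simp only [Set.indicator_of_mem (e _ _), Set.indicator_of_mem (Set.mem_Ioi.2 hx)]
    rfl
  · have e : ∀ s e, streamCons ((x, s), e) ∉ {e : ℕ → ℝ × ℝ | t < (e 0).1} := fun s e => hx
    have e' : x ∉ Set.Ioi t := hx
    simp only [Set.indicator_of_notMem (e _ _), Set.indicator_of_notMem e']
    simp

lemma map_advance_streamLaw {r t : ℝ} [IsProbabilityMeasure (expMeasure r)]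
    (ν : Measure ℝ) [IsProbabilityMeasure ν] (ht : 0 ≤ t) :
    ((streamLaw r ν).restrict {e | t < (e 0).1}).map (advance t) =
      ENNReal.ofReal (Real.exp (-(r * t))) • streamLaw r ν := by
  have hadv : Measurable (advance t) := measurable_advance.comp measurable_prodMk_left
  refine Measure.ext_of_lintegral _ fun f hf => ?_
  rw [lintegral_map hf hadv, setLIntegral_streamLaw_advance ν ht hf, lintegral_smul_measure,
    smul_eq_mul]

variable {M : ℕ} (lam : Fin M → ℝ) [∀ n, IsProbabilityMeasure (expMeasure (lam n))]
  (ν : Fin M → Measure ℝ) [∀ n, IsProbabilityMeasure (ν n)]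

/-- The law of independent streams. -/
noncomputable def streamsLaw : Measure (Fin M → ℕ → ℝ × ℝ) :=
  Measure.pi fun n => streamLaw (lam n) (ν n)

instance : IsProbabilityMeasure (streamsLaw lam ν) := by
  unfold streamsLaw; infer_instance

/-- The event of no arrival by time `t` is a product over the streams, so the exponential factors
multiply and the rates add. -/
lemma map_advance_streamsLaw {t : ℝ} (ht : 0 ≤ t) :
    ((streamsLaw lam ν).restrict {e | ∀ n, t < (e n 0).1}).map (fun e n => advance t (e n)) =
      ENNReal.ofReal (Real.exp (-((∑ n, lam n) * t))) • streamsLaw lam ν := by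
  have hadv : Measurable (advance t) := measurable_advance.comp measurable_prodMk_left
  have hs : {e : Fin M → ℕ → ℝ × ℝ | ∀ n, t < (e n 0).1} =
      Set.univ.pi fun _ => {e | t < (e 0).1} := by ext; simp
  have : ∀ n, SigmaFinite
      (((streamLaw (lam n) (ν n)).restrict {e | t < (e 0).1}).map (advance t)) := fun n => by
    have : IsFiniteMeasure
        (((streamLaw (lam n) (ν n)).restrict {e | t < (e 0).1}).map (advance t)) :=
      Measure.isFiniteMeasure_map _ _
    infer_instance
  unfold streamsLaw
  rw [hs, Measure.restrict_pi_pi, Measure.pi_map_pi fun n => hadv.aemeasurable]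
  refine Measure.pi_eq fun s hms => ?_
  rw [Measure.smul_apply, Measure.pi_pi, smul_eq_mul]
  simp_rw [map_advance_streamLaw (ν _) ht, Measure.smul_apply, smul_eq_mul]
  rw [Finset.prod_mul_distrib, ← ENNReal.ofReal_prod_of_nonneg fun _ _ => (Real.exp_pos _).le,
    ← Real.exp_sum, Finset.sum_neg_distrib, Finset.sum_mul]

end Laws

/-! ### The law of the marks of the merged stream -/

section Marks

variable {N : ℕ} (lam : Fin N → ℝ) (ν : Fin N → Measure ℝ)

lemma sum_ofReal_div_sum_eq_one {lam : Fin N → ℝ} (hlam : ∀ n, 0 < lam n)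
    (hsum : 0 < ∑ m, lam m) :
    ∑ n, ENNReal.ofReal (lam n / ∑ m, lam m) = 1 := by
  rw [← ENNReal.ofReal_sum_of_nonneg fun n _ => (div_pos (hlam n) hsum).le, ← Finset.sum_div,
    div_self hsum.ne', ENNReal.ofReal_one]

/-- The law of the class and the service time of a packet. -/
noncomputable def markLaw : Measure (Fin N × ℝ) :=
  ∑ n, ENNReal.ofReal (lam n / ∑ m, lam m) • (ν n).map (Prod.mk n)

lemma lintegral_markLaw {f : Fin N × ℝ → ENNReal} (hf : Measurable f) :
    ∫⁻ z, f z ∂markLaw lam ν =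
      ∑ n, ENNReal.ofReal (lam n / ∑ m, lam m) * ∫⁻ s, f (n, s) ∂ν n := by
  rw [markLaw, lintegral_finsetSum_measure]
  refine Finset.sum_congr rfl fun n _ => ?_
  rw [lintegral_smul_measure, lintegral_map hf measurable_prodMk_left, smul_eq_mul]

variable {lam} in
lemma isProbabilityMeasure_markLaw [NeZero N] [∀ n, IsProbabilityMeasure (ν n)]
    (hlam : ∀ n, 0 < lam n) :   IsProbabilityMeasure (markLaw lam ν) := by
  constructor
  rw [← lintegral_one, lintegral_markLaw _ _ measurable_const]
  simp [sum_ofReal_div_sum_eq_one hlam (Finset.sum_pos (fun n _ => hlam n) Finset.univ_nonempty)]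

end Marks

/-! ### The first arrival of the merged stream and the streams after it -/

section Step

variable {N : ℕ}

/-- The streams after the arrival of the first packet, if it is of class `n`. -/
def dropFirst (n : Fin N) (e : Fin N → ℕ → ℝ × ℝ) : Fin N → ℕ → ℝ × ℝ :=
  fun m => if m = n then fun j => e n (j + 1) else advance (e n 0).1 (e m)

lemma measurable_dropFirst (n : Fin N) : Measurable (dropFirst n) := by
  refine measurable_pi_lambda _ fun m => ?_
  by_cases h : m = n
  · simp only [dropFirst, h, if_true]; fun_prop
  · simp only [dropFirst, h, if_false]
    have : Measurable (fun e : Fin N → ℕ → ℝ × ℝ => ((e n 0).1, e m)) := by fun_prop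
    exact measurable_advance.comp this

/-- The first packet is of class `n`. -/
def FirstIs (n : Fin N) (e : Fin N → ℕ → ℝ × ℝ) : Prop := ∀ m, m ≠ n → (e n 0).1 < (e m 0).1

lemma measurableSet_firstIs (n : Fin N) : MeasurableSet {e | FirstIs n e} := by
  unfold FirstIs
  simp only [Set.ofPred_forall]
  exact MeasurableSet.iInter fun m => MeasurableSet.iInter fun _ =>
    measurableSet_lt (by fun_prop) (by fun_prop)

variable (lam : Fin N → ℝ) [∀ n, IsProbabilityMeasure (expMeasure (lam n))]
  (ν : Fin N → Measure ℝ) [∀ n, IsProbabilityMeasure (ν n)]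

/-- Condition on the stream of class `n`, with first arrival at `x`. The others are all later with
probability `exp (-(b x))`, where `b` is their total rate, and on this event their advanced versions
have the original law. The factor `exp (-(b x))` turns the rate `lam n` into the total rate and
leaves the weight `lam n / ∑ m, lam m`. -/
lemma setLIntegral_firstIs (hlam : ∀ n, 0 < lam n) (n : Fin N)
    {Φ : (ℝ × ℝ) × (Fin N → ℕ → ℝ × ℝ) → ENNReal} (hΦ : Measurable Φ) :
    ∫⁻ e in {e | FirstIs n e}, Φ (e n 0, dropFirst n e) ∂streamsLaw lam ν =
      ENNReal.ofReal (lam n / ∑ m, lam m) *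
        ∫⁻ x, ∫⁻ s, ∫⁻ e, Φ ((x, s), e) ∂streamsLaw lam ν ∂ν n ∂expMeasure (∑ m, lam m) := by
  obtain ⟨M, rfl⟩ : ∃ M, N = M + 1 := ⟨N - 1, by have := n.pos; omega⟩
  set lam' : Fin M → ℝ := fun j => lam (n.succAbove j) with hlam'
  set ν' : Fin M → Measure ℝ := fun j => ν (n.succAbove j) with hν'
  set b : ℝ := ∑ j, lam' j with hb
  have hb0 : 0 ≤ b := Finset.sum_nonneg fun j _ => (hlam _).le
  have hsum : ∑ m, lam m = lam n + b := Fin.sum_univ_succAbove lam n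
  have hmp := (measurePreserving_piFinSuccAbove (fun n => streamLaw (lam n) (ν n)) n).symm
  have hsplit : ∀ {G : (Fin (M + 1) → ℕ → ℝ × ℝ) → ENNReal}, Measurable G →
      ∫⁻ e, G e ∂streamsLaw lam ν =
        ∫⁻ f, ∫⁻ g, G (n.insertNth f g) ∂streamsLaw lam' ν' ∂streamLaw (lam n) (ν n) := by
    intro G hG
    rw [streamsLaw, ← hmp.map_eq, lintegral_map hG hmp.measurable,
      lintegral_prod (fun p => G _) (hG.comp hmp.measurable).aemeasurable]
    rfl
  have hins : Measurable (fun p : (ℕ → ℝ × ℝ) × (Fin M → ℕ → ℝ × ℝ) =>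
      (n.insertNth p.1 p.2 : Fin (M + 1) → ℕ → ℝ × ℝ)) := hmp.measurable
  have hS := measurableSet_firstIs n
  have hstep : Measurable (fun e : Fin (M + 1) → ℕ → ℝ × ℝ => Φ (e n 0, dropFirst n e)) := by
    have := measurable_dropFirst n
    fun_prop
  rw [← lintegral_indicator hS, hsplit (hstep.indicator hS)]
  -- the other streams, given the stream of class `n`
  have hinner : ∀ f : ℕ → ℝ × ℝ, 0 < (f 0).1 →
      ∫⁻ g, {e | FirstIs n e}.indicator (fun e => Φ (e n 0, dropFirst n e)) (n.insertNth f g)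
        ∂streamsLaw lam' ν' = ENNReal.ofReal (Real.exp (-(b * (f 0).1))) *
          ∫⁻ g, Φ (f 0, n.insertNth (fun j => f (j + 1)) g) ∂streamsLaw lam' ν' := by
    intro f hf
    have hadv : Measurable (fun (e : Fin M → ℕ → ℝ × ℝ) m => advance (f 0).1 (e m)) :=
      measurable_pi_lambda _ fun m =>
        (measurable_advance.comp measurable_prodMk_left).comp (measurable_pi_apply m)
    have hs' : MeasurableSet {g : Fin M → ℕ → ℝ × ℝ | ∀ m, (f 0).1 < (g m 0).1} := by
      simp only [Set.ofPred_forall]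
      exact MeasurableSet.iInter fun m => measurableSet_lt (by fun_prop) (by fun_prop)
    have hΨ : Measurable (fun g => Φ (f 0, n.insertNth (fun j => f (j + 1)) g)) :=
      hΦ.comp (measurable_const.prodMk (hins.comp measurable_prodMk_left))
    have h1 := map_advance_streamsLaw lam' ν' hf.le
    have h2 := congrArg (fun ρ => ∫⁻ g, Φ (f 0, n.insertNth (fun j => f (j + 1)) g) ∂ρ) h1
    simp only [lintegral_smul_measure, smul_eq_mul] at h2
    rw [lintegral_map hΨ hadv] at h2
    rw [← h2, ← lintegral_indicator hs']
    refine lintegral_congr fun g => ?_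
    have hiff : (n.insertNth f g : Fin (M + 1) → ℕ → ℝ × ℝ) ∈ {e | FirstIs n e} ↔
        g ∈ {g : Fin M → ℕ → ℝ × ℝ | ∀ m, (f 0).1 < (g m 0).1} := by
      simp only [Set.mem_ofPred_eq, FirstIs]
      refine ⟨fun h m => ?_, fun h m hm => ?_⟩
      · simpa using h (n.succAbove m) (Fin.succAbove_ne n m)
      · obtain ⟨j, rfl⟩ := Fin.exists_succAbove_eq hm
        simpa using h j
    have hdrop : dropFirst n (n.insertNth f g) =
        (n.insertNth (fun j => f (j + 1)) fun m => advance (f 0).1 (g m) :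
          Fin (M + 1) → ℕ → ℝ × ℝ) := by
      funext m
      rcases Fin.eq_self_or_eq_succAbove n m with rfl | ⟨j, rfl⟩
      · simp [dropFirst]
      · simp [dropFirst, Fin.succAbove_ne]
    by_cases hg : g ∈ {g : Fin M → ℕ → ℝ × ℝ | ∀ m, (f 0).1 < (g m 0).1}
    · rw [Set.indicator_of_mem (hiff.2 hg), Set.indicator_of_mem hg, hdrop]
      simp
    · rw [Set.indicator_of_notMem (mt hiff.1 hg), Set.indicator_of_notMem hg]
  have hm1 : Measurable (fun f => ∫⁻ g, {e | FirstIs n e}.indicator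
      (fun e => Φ (e n 0, dropFirst n e)) (n.insertNth f g) ∂streamsLaw lam' ν') :=
    ((hstep.indicator hS).comp hins).lintegral_prod_right'
  rw [lintegral_streamLaw _ _ hm1]
  have hm2 : Measurable (fun x => ∫⁻ s, ∫⁻ e, Φ ((x, s), e) ∂streamsLaw lam ν ∂ν n) := by
    have h1 : Measurable (fun z : ℝ × ℝ => ∫⁻ e, Φ (z, e) ∂streamsLaw lam ν) :=
      hΦ.lintegral_prod_right'
    exact h1.lintegral_prod_right'
  rw [hsum, ← lintegral_exp_neg_mul_expMeasure (hlam n) hb0 hm2]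
  refine lintegral_congr_ae ?_
  filter_upwards [ae_pos_expMeasure (lam n)] with x hx
  have hm3 : ∀ z : ℝ × ℝ, Measurable (fun e : ℕ → ℝ × ℝ =>
      ∫⁻ g, Φ (z, n.insertNth e g) ∂streamsLaw lam' ν') := fun z => by
    have : Measurable (fun p : (ℕ → ℝ × ℝ) × (Fin M → ℕ → ℝ × ℝ) => Φ (z, n.insertNth p.1 p.2)) :=
      hΦ.comp (measurable_const.prodMk hins)
    exact this.lintegral_prod_right'
  have hm4 : Measurable (fun s => ∫⁻ e, Φ ((x, s), e) ∂streamsLaw lam ν) := by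
    have h1 : Measurable (fun z : ℝ × ℝ => ∫⁻ e, Φ (z, e) ∂streamsLaw lam ν) :=
      hΦ.lintegral_prod_right'
    exact h1.comp measurable_prodMk_left
  rw [← lintegral_const_mul _ hm4]
  refine lintegral_congr fun s => ?_
  rw [hsplit (G := fun e => Φ ((x, s), e)) (hΦ.comp measurable_prodMk_left),
    ← lintegral_const_mul _ (hm3 (x, s))]
  refine lintegral_congr fun e => ?_
  exact hinner (streamCons ((x, s), e)) hx

lemma FirstIs.unique {n m : Fin N} {e : Fin N → ℕ → ℝ × ℝ} (hn : FirstIs n e)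
    (hm : FirstIs m e) : n = m := by
  by_contra h
  exact lt_asymm (hn m (Ne.symm h)) (hm n h)

variable [NeZero N]

open Classical in
/-- The class of the first packet. -/
noncomputable def firstClass (e : Fin N → ℕ → ℝ × ℝ) : Fin N :=
  if h : ∃ n, FirstIs n e then h.choose else 0

lemma FirstIs.firstClass_eq {n : Fin N} {e : Fin N → ℕ → ℝ × ℝ} (h : FirstIs n e) :
    firstClass e = n := by
  have hex : ∃ n, FirstIs n e := ⟨n, h⟩
  rw [firstClass, dif_pos hex]
  exact hex.choose_spec.unique h

lemma measurable_firstClass : Measurable (firstClass (N := N)) := by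
  refine measurable_to_countable' fun n => ?_
  have hU : MeasurableSet (⋃ m, {e : Fin N → ℕ → ℝ × ℝ | FirstIs m e}) :=
    MeasurableSet.iUnion measurableSet_firstIs
  have e : firstClass ⁻¹' {n} = {e : Fin N → ℕ → ℝ × ℝ | FirstIs n e} ∪
      ((⋃ m, {e : Fin N → ℕ → ℝ × ℝ | FirstIs m e})ᶜ ∩ {_e | (0 : Fin N) = n}) := by
    ext e
    simp only [Set.mem_preimage, Set.mem_singleton_iff, Set.mem_union, Set.mem_ofPred_eq,
      Set.mem_inter_iff, Set.mem_compl_iff, Set.mem_iUnion]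
    by_cases h : ∃ m, FirstIs m e
    · obtain ⟨m, hm⟩ := h
      rw [hm.firstClass_eq]
      exact ⟨fun h => Or.inl (h ▸ hm), fun h => h.elim (fun h => hm.unique h)
        fun h => absurd ⟨m, hm⟩ h.1⟩
    · have h0 : firstClass e = 0 := by rw [firstClass, dif_neg h]
      rw [h0]
      exact ⟨fun h' => Or.inr ⟨h, h'⟩, fun h' => h'.elim (fun h' => absurd ⟨n, h'⟩ h) And.right⟩
  rw [e]
  exact (measurableSet_firstIs n).union (hU.compl.inter (MeasurableSet.const _))

/-- What is observed at the first arrival: its time, and the class and the service time of the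
packet. -/
noncomputable def firstPacket (e : Fin N → ℕ → ℝ × ℝ) : ℝ × (Fin N × ℝ) :=
  ((e (firstClass e) 0).1, firstClass e, (e (firstClass e) 0).2)

/-- The streams after the first arrival. -/
noncomputable def nextStreams (e : Fin N → ℕ → ℝ × ℝ) : Fin N → ℕ → ℝ × ℝ :=
  dropFirst (firstClass e) e

lemma measurable_firstPacket : Measurable (firstPacket (N := N)) := by
  have h : Measurable (fun p : Fin N × (Fin N → ℕ → ℝ × ℝ) =>
      ((p.2 p.1 0).1, p.1, (p.2 p.1 0).2)) :=
    measurable_from_prod_countable_right fun n => by fun_prop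
  exact h.comp (measurable_firstClass.prodMk measurable_id)

lemma measurable_nextStreams : Measurable (nextStreams (N := N)) := by
  have h : Measurable (fun p : Fin N × (Fin N → ℕ → ℝ × ℝ) => dropFirst p.1 p.2) :=
    measurable_from_prod_countable_right fun n => measurable_dropFirst n
  exact h.comp (measurable_firstClass.prodMk measurable_id)

/-- The disjoint events `FirstIs n` have probabilities `lam n / ∑ m, lam m`, which add up to `1`; no
separate argument is needed to exclude ties. -/
lemma ae_exists_firstIs (hlam : ∀ n, 0 < lam n) :
    ∀ᵐ e ∂streamsLaw lam ν, ∃ n, FirstIs n e := by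
  have hL : 0 < ∑ m, lam m := Finset.sum_pos (fun n _ => hlam n) Finset.univ_nonempty
  have := isProbabilityMeasure_expMeasure hL
  have hU : MeasurableSet (⋃ m, {e : Fin N → ℕ → ℝ × ℝ | FirstIs m e}) :=
    MeasurableSet.iUnion measurableSet_firstIs
  have h1 : streamsLaw lam ν (⋃ m, {e | FirstIs m e}) = 1 := by
    rw [measure_iUnion (fun n m hnm => Set.disjoint_left.2 fun e hn hm => hnm (hn.unique hm))
      measurableSet_firstIs, tsum_fintype, ← sum_ofReal_div_sum_eq_one hlam hL]
    refine Finset.sum_congr rfl fun n _ => ?_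
    have := setLIntegral_firstIs lam ν hlam n (Φ := fun _ => 1) measurable_const
    simpa using this
  have h2 := (prob_compl_eq_zero_iff hU).2 h1
  rw [ae_iff]
  convert h2 using 2
  ext e
  simp

/-- The first packet is independent of the streams after its arrival, and these have the same law
as at the beginning. -/
lemma map_firstPacket_nextStreams (hlam : ∀ n, 0 < lam n) :
    (streamsLaw lam ν).map (fun e => (firstPacket e, nextStreams e)) =
      ((expMeasure (∑ m, lam m)).prod (markLaw lam ν)).prod (streamsLaw lam ν) := by
  have hL : 0 < ∑ m, lam m := Finset.sum_pos (fun n _ => hlam n) Finset.univ_nonempty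
  have := isProbabilityMeasure_expMeasure hL
  have := isProbabilityMeasure_markLaw ν hlam
  have hm : Measurable (fun e : Fin N → ℕ → ℝ × ℝ => (firstPacket e, nextStreams e)) :=
    measurable_firstPacket.prodMk measurable_nextStreams
  refine Measure.ext_of_lintegral _ fun f hf => ?_
  have hm1 : Measurable (fun z => ∫⁻ e, f (z, e) ∂streamsLaw lam ν) := hf.lintegral_prod_right'
  rw [lintegral_map hf hm, lintegral_prod _ hf.aemeasurable, lintegral_prod _ hm1.aemeasurable]
  have hU : (⋃ m, {e : Fin N → ℕ → ℝ × ℝ | FirstIs m e}) =ᵐ[streamsLaw lam ν] Set.univ := by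
    rw [eventuallyEq_univ]
    filter_upwards [ae_exists_firstIs lam ν hlam] with e he
    simpa using he
  have hcover : ∫⁻ e, f (firstPacket e, nextStreams e) ∂streamsLaw lam ν =
      ∑ n, ∫⁻ e in {e | FirstIs n e}, f (firstPacket e, nextStreams e) ∂streamsLaw lam ν := by
    rw [← setLIntegral_univ, ← setLIntegral_congr hU, lintegral_iUnion measurableSet_firstIs
      (fun n m hnm => Set.disjoint_left.2 fun e hn hm => hnm (hn.unique hm)), tsum_fintype]
  rw [hcover]
  have hn : ∀ n, ∫⁻ e in {e | FirstIs n e}, f (firstPacket e, nextStreams e) ∂streamsLaw lam ν =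
      ∫⁻ x, ENNReal.ofReal (lam n / ∑ m, lam m) *
        ∫⁻ s, ∫⁻ e, f ((x, n, s), e) ∂streamsLaw lam ν ∂ν n ∂expMeasure (∑ m, lam m) := by
    intro n
    have hΦ : Measurable (fun p : (ℝ × ℝ) × (Fin N → ℕ → ℝ × ℝ) => f ((p.1.1, n, p.1.2), p.2)) :=
      hf.comp (by fun_prop)
    have h1 : Measurable (fun z : ℝ × ℝ => ∫⁻ e, f ((z.1, n, z.2), e) ∂streamsLaw lam ν) :=
      hm1.comp (g := fun z => ∫⁻ e, f (z, e) ∂streamsLaw lam ν)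
        (f := fun z : ℝ × ℝ => (z.1, n, z.2)) (by fun_prop)
    rw [lintegral_const_mul _ h1.lintegral_prod_right', ← setLIntegral_firstIs lam ν hlam n hΦ]
    refine setLIntegral_congr_fun (measurableSet_firstIs n) fun e he => ?_
    have he' : FirstIs n e := he
    simp only [firstPacket, nextStreams, he'.firstClass_eq]
  simp_rw [hn]
  rw [← lintegral_finsetSum]
  · refine lintegral_congr fun x => ?_
    rw [lintegral_markLaw lam ν (f := fun z => ∫⁻ e, f ((x, z), e) ∂streamsLaw lam ν)]
    exact hm1.comp measurable_prodMk_left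
  · intro n _
    have h1 : Measurable (fun z : ℝ × ℝ => ∫⁻ e, f ((z.1, n, z.2), e) ∂streamsLaw lam ν) :=
      hm1.comp (g := fun z => ∫⁻ e, f (z, e) ∂streamsLaw lam ν)
        (f := fun z : ℝ × ℝ => (z.1, n, z.2)) (by fun_prop)
    exact h1.lintegral_prod_right'.const_mul _

end Step

/-! ### Sample paths -/

section Path

variable {N : ℕ} [NeZero N]

lemma earliest_le (f : Fin N → ℝ) (m : Fin N) : f (earliest f) ≤ f m :=
  Classical.choose_spec (Finite.exists_min f) m

lemma earliest_eq {f : Fin N → ℝ} {n : Fin N} (h : ∀ m, m ≠ n → f n < f m) : earliest f = n := by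
  by_contra hne
  exact (earliest_le f n).not_gt (h _ hne)

/-- The generation time of the packet before the `i`-th one, or `0` if there is none. -/
noncomputable def prevGenerationTime (I : Fin N → ℕ → ℝ) : ℕ → ℝ
  | 0 => 0
  | i + 1 => generationTime I i

/-- The time between the arrivals of the `(i - 1)`-st and the `i`-th packet. -/
noncomputable def interTime (I : Fin N → ℕ → ℝ) (i : ℕ) : ℝ :=
  generationTime I i - prevGenerationTime I i

lemma arrivedBefore_succ (I : Fin N → ℕ → ℝ) (i : ℕ) (m : Fin N) :
    arrivedBefore I (i + 1) m =
      if m = packetClass I i then arrivedBefore I i m + 1 else arrivedBefore I i m := by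
  change Function.update (arrivedBefore I i) (packetClass I i)
    (arrivedBefore I i (packetClass I i) + 1) m = _
  by_cases h : m = packetClass I i
  · subst h; simp
  · simp [h]

lemma arrivedBefore_eq_count (I : Fin N → ℕ → ℝ) (n : Fin N) (i : ℕ) :
    arrivedBefore I i n = Nat.count (fun j => packetClass I j = n) i := by
  induction i with
  | zero => simp [arrivedBefore]
  | succ i ih =>
    rw [arrivedBefore_succ, Nat.count_succ, ih]
    by_cases h : packetClass I i = n
    · simp [h]
    · simp [h, Ne.symm h]

lemma arrivalTime_succ {N : ℕ} (I : Fin N → ℕ → ℝ) (n : Fin N) (k : ℕ) :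
    arrivalTime I n (k + 1) = arrivalTime I n k + I n (k + 1) :=
  Finset.sum_range_succ _ _

/-- The streams seen from the arrival of a packet. -/
lemma iterate_nextStreams {I X : Fin N → ℕ → ℝ}
    (h : ∀ i, ∃ n, FirstIs n (nextStreams^[i] fun n j => (I n j, X n j))) (i : ℕ) :
    (∀ m, nextStreams^[i] (fun n j => (I n j, X n j)) m 0 =
      (arrivalTime I m (arrivedBefore I i m) - prevGenerationTime I i,
        X m (arrivedBefore I i m))) ∧
    (∀ m j, nextStreams^[i] (fun n j => (I n j, X n j)) m (j + 1) =
      (I m (arrivedBefore I i m + (j + 1)), X m (arrivedBefore I i m + (j + 1)))) ∧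
    firstClass (nextStreams^[i] fun n j => (I n j, X n j)) = packetClass I i := by
  -- Subtracting the common time `prevGenerationTime I i` does not affect comparisons, and
  -- strictness leaves `earliest` a single possible choice.
  have hclass : ∀ i, (∀ m, nextStreams^[i] (fun n j => (I n j, X n j)) m 0 =
      (arrivalTime I m (arrivedBefore I i m) - prevGenerationTime I i,
        X m (arrivedBefore I i m))) →
      firstClass (nextStreams^[i] fun n j => (I n j, X n j)) = packetClass I i := by
    intro i hi
    obtain ⟨n, hn⟩ := h i
    rw [hn.firstClass_eq]
    refine (earliest_eq fun m hm => ?_).symm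
    have := hn m hm
    rw [hi, hi] at this
    simpa using this
  induction i with
  | zero =>
    have h0 : ∀ m, nextStreams^[0] (fun n j => (I n j, X n j)) m 0 =
      (arrivalTime I m (arrivedBefore I 0 m) - prevGenerationTime I 0,
        X m (arrivedBefore I 0 m)) := by
      intro m; simp [arrivedBefore, arrivalTime, prevGenerationTime]
    exact ⟨h0, fun m j => by simp [arrivedBefore], hclass 0 h0⟩
  | succ i ih =>
    obtain ⟨ih0, ih1, ihc⟩ := ih
    have key : (∀ m, nextStreams^[i + 1] (fun n j => (I n j, X n j)) m 0 =
      (arrivalTime I m (arrivedBefore I (i + 1) m) - prevGenerationTime I (i + 1),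
        X m (arrivedBefore I (i + 1) m))) ∧
      (∀ m j, nextStreams^[i + 1] (fun n j => (I n j, X n j)) m (j + 1) =
        (I m (arrivedBefore I (i + 1) m + (j + 1)),
          X m (arrivedBefore I (i + 1) m + (j + 1)))) := by
      simp only [Function.iterate_succ_apply', nextStreams, dropFirst]
      rw [ihc]
      have hg : prevGenerationTime I (i + 1) =
        arrivalTime I (packetClass I i) (arrivedBefore I i (packetClass I i)) := rfl
      refine ⟨fun m => ?_, fun m j => ?_⟩
      · rw [arrivedBefore_succ, hg]
        by_cases hm : m = packetClass I i
        · rw [if_pos hm, if_pos hm]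
          subst hm
          rw [ih1, arrivalTime_succ]
          simp
        · rw [if_neg hm, if_neg hm]
          simp only [advance, streamCons]
          rw [ih0, ih0]
          simp
      · rw [arrivedBefore_succ]
        by_cases hm : m = packetClass I i
        · rw [if_pos hm, if_pos hm]
          subst hm
          rw [ih1]
          ring_nf
        · rw [if_neg hm, if_neg hm]
          simp only [advance, streamCons]
          rw [ih1]
    exact ⟨key.1, key.2, hclass _ key.1⟩

lemma firstPacket_iterate_nextStreams {I X : Fin N → ℕ → ℝ}
    (h : ∀ i, ∃ n, FirstIs n (nextStreams^[i] fun n j => (I n j, X n j))) (i : ℕ) :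
    firstPacket (nextStreams^[i] fun n j => (I n j, X n j)) =
      (interTime I i, packetClass I i, serviceTime I X i) := by
  obtain ⟨h0, _, hc⟩ := iterate_nextStreams h i
  rw [firstPacket, hc, h0]
  rfl

/-- Subtracting the generation time inside the maximum that defines `serviceStart` gives the
recursion. The value `interTime I 0` is never used by `lindley`. -/
lemma waitingTime_eq_lindley (I X : Fin N → ℕ → ℝ) (i : ℕ) :
    waitingTime I X i = lindley (serviceTime I X) (interTime I) i := by
  induction i with
  | zero => simp [waitingTime, serviceStart, lindley]
  | succ i ih =>
    rw [lindley, ← ih, waitingTime, serviceStart, waitingTime, interTime, prevGenerationTime,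
      max_comm, ← max_sub_sub_right]
    congr 1 <;> ring

lemma sum_range_count_nth {p : ℕ → Prop} [DecidablePred p] (f : ℕ → ℝ) (m : ℕ) :
    ∑ k ∈ Finset.range (Nat.count p m), f (Nat.nth p k) =
      ∑ i ∈ Finset.range m, if p i then f i else 0 := by
  induction m with
  | zero => simp
  | succ m ih =>
    rw [Finset.sum_range_succ, ← ih, Nat.count_succ]
    split_ifs with h
    · rw [Finset.sum_range_succ, Nat.nth_count h]
    · simp

/-! ### Peaks of the status age -/

variable {I X : Fin N → ℕ → ℝ}

lemma receptionTime_strictMono (hX : ∀ n k, 0 < X n k) : StrictMono (receptionTime I X) := by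
  refine strictMono_nat_of_lt_succ fun i => ?_
  have h1 : receptionTime I X i ≤ serviceStart I X (i + 1) := le_max_right _ _
  have h2 : 0 < serviceTime I X (i + 1) := hX _ _
  simp only [receptionTime] at *
  linarith

lemma generationTime_of_packetClass_eq {n : Fin N} {i : ℕ} (h : packetClass I i = n) :
    generationTime I i = arrivalTime I n (Nat.count (fun j => packetClass I j = n) i) := by
  rw [generationTime, h, arrivedBefore_eq_count]

/-- Receptions occur in order of arrival, so the class-`n` packets received by time `t` are exactly
the first `k`, and the freshest is the `(k - 1)`-st. For `k = 0` the empty sum is the age counted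
from time `0`. -/
lemma age_eq_of_lt (hI : ∀ n k, 0 < I n k) (hX : ∀ n k, 0 < X n k) {n : Fin N}
    (hinf : {i | packetClass I i = n}.Infinite) {k : ℕ} {t : ℝ}
    (hlo : ∀ l < k, dropTime I X n l ≤ t) (hhi : t < dropTime I X n k) :
    age I X n t = t - ∑ j ∈ Finset.range k, I n j := by
  have hmono : Monotone (fun l => ∑ j ∈ Finset.range l, I n j) := monotone_nat_of_le_succ fun l => by
    rw [Finset.sum_range_succ]; linarith [hI n l]
  rw [age]
  congr 1
  refine IsGreatest.csSup_eq ⟨?_, ?_⟩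
  · cases k with
    | zero => left; simp
    | succ k =>
      right
      have hp : packetClass I (Nat.nth (fun i => packetClass I i = n) k) = n :=
        Nat.nth_mem_of_infinite hinf k
      refine ⟨Nat.nth (fun i => packetClass I i = n) k, hp, hlo k k.lt_succ_self, ?_⟩
      rw [generationTime_of_packetClass_eq hp, Nat.count_nth_of_infinite hinf]
      rfl
  · rintro g (rfl | ⟨i, hi, hit, rfl⟩)
    · exact Finset.sum_nonneg fun j _ => (hI n j).le
    · rw [generationTime_of_packetClass_eq hi]
      refine hmono ?_
      have h1 : i < Nat.nth (fun i => packetClass I i = n) k :=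
        (receptionTime_strictMono hX).lt_iff_lt.1 (hit.trans_lt hhi)
      have h2 : Nat.nth (fun i => packetClass I i = n)
          (Nat.count (fun j => packetClass I j = n) i) = i := Nat.nth_count hi
      rw [← h2] at h1
      exact (Nat.nth_lt_nth hinf).1 h1

/-- Just before the drop, the age refers to the previous class-`n` packet, generated `I n k` before
the `k`-th one; the latter spends its waiting time and `X n k` in the system. -/
lemma peakAge_eq (hI : ∀ n k, 0 < I n k) (hX : ∀ n k, 0 < X n k) {n : Fin N}
    (hinf : {i | packetClass I i = n}.Infinite) (k : ℕ) :
    peakAge I X n k =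
      I n k + X n k + waitingTime I X (Nat.nth (fun i => packetClass I i = n) k) := by
  set i := Nat.nth (fun i => packetClass I i = n) k with hi
  have hp : packetClass I i = n := Nat.nth_mem_of_infinite hinf k
  have hcount : Nat.count (fun j => packetClass I j = n) i = k := Nat.count_nth_of_infinite hinf k
  have hgen : generationTime I i = ∑ j ∈ Finset.range k, I n j + I n k := by
    rw [generationTime_of_packetClass_eq hp, hcount, arrivalTime, Finset.sum_range_succ]
  have hserv : serviceTime I X i = X n k := by
    rw [serviceTime, hp, arrivedBefore_eq_count, hcount]
  have hdrop : dropTime I X n k = serviceStart I X i + X n k := by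
    rw [dropTime, receptionTime, ← hi, hserv]
  have hval : I n k + X n k + waitingTime I X i =
      dropTime I X n k - ∑ j ∈ Finset.range k, I n j := by
    rw [waitingTime, hdrop, hgen]; ring
  rw [hval, peakAge]
  have hdm : StrictMono (dropTime I X n) :=
    (receptionTime_strictMono hX).comp (Nat.nth_strictMono hinf)
  have hev : ∀ᶠ t in 𝓝[<] dropTime I X n k, age I X n t = t - ∑ j ∈ Finset.range k, I n j := by
    -- The left limit sees only times after the previous drop; before the first drop any lower bound
    -- will do.
    obtain ⟨lo, hlo, hlo'⟩ : ∃ lo < dropTime I X n k, ∀ l < k, dropTime I X n l ≤ lo := by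
      cases k with
      | zero => exact ⟨dropTime I X n 0 - 1, by linarith, fun l hl => absurd hl (by omega)⟩
      | succ k => exact ⟨dropTime I X n k, hdm k.lt_succ_self,
          fun l hl => hdm.monotone (by omega)⟩
    filter_upwards [Ioo_mem_nhdsLT hlo] with t ht
    exact age_eq_of_lt hI hX hinf (fun l hl => (hlo' l hl).trans ht.1.le) ht.2
  refine leftLim_eq_of_tendsto ?_
  refine Tendsto.congr' (EventuallyEq.symm hev) ?_
  exact ((continuous_id.sub continuous_const).tendsto _).mono_left nhdsWithin_le_nhds

end Path

/-! ### The queue with exponential interarrival times and independent marks -/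

section Marked

variable {Ω : Type*} [mΩ : MeasurableSpace Ω] {μ : Measure Ω}

/-- The strong law of large numbers for a function of independent variables of law `Q`. -/
lemma ae_tendsto_average_comp {F : Type*} [MeasurableSpace F] {Q : Measure F} {ξ : ℕ → Ω → F}
    (hξ : ∀ i, Measurable (ξ i)) (hind : iIndepFun ξ μ) (hlaw : ∀ i, μ.map (ξ i) = Q)
    {f : F → ℝ} (hf : Measurable f) (hint : Integrable f Q) :
    ∀ᵐ ω ∂μ, Tendsto (fun n : ℕ => (∑ i ∈ Finset.range n, f (ξ i ω)) / n) atTop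
      (𝓝 (∫ z, f z ∂Q)) := by
  have h1 : Integrable (fun ω => f (ξ 0 ω)) μ := by
    rw [← hlaw 0] at hint
    exact hint.comp_measurable (hξ 0)
  have h2 : ∫ ω, f (ξ 0 ω) ∂μ = ∫ z, f z ∂Q := by
    rw [← hlaw 0, integral_map (hξ 0).aemeasurable hf.aestronglyMeasurable]
  have h3 := strong_law_ae_real (fun i ω => f (ξ i ω)) h1
    (fun i j hij => (hind.indepFun hij).comp hf hf)
    (fun i => IdentDistrib.comp ⟨(hξ i).aemeasurable, (hξ 0).aemeasurable,
      (hlaw i).trans (hlaw 0).symm⟩ hf)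
  rwa [h2] at h3

/-- The filtration generated by a sequence. -/
def historyFiltration {F : Type*} [MeasurableSpace F] {ξ : ℕ → Ω → F}
    (hξ : ∀ i, Measurable (ξ i)) : Filtration ℕ mΩ where
  seq i := ⨆ j ≤ i, MeasurableSpace.comap (ξ j) inferInstance
  mono' _ _ hij := biSup_mono fun _ => ge_trans hij
  le' _ := iSup₂_le fun j _ => (hξ j).comap_le

lemma measurable_historyFiltration {F : Type*} [MeasurableSpace F] {ξ : ℕ → Ω → F}
    (hξ : ∀ i, Measurable (ξ i)) {i j : ℕ} (hij : j ≤ i) :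
    Measurable[historyFiltration hξ i] (ξ j) :=
  Measurable.of_comap_le (le_iSup₂ (f := fun j (_ : j ≤ i) =>
    MeasurableSpace.comap (ξ j) inferInstance) j hij)

lemma indep_historyFiltration {F : Type*} [MeasurableSpace F] {ξ : ℕ → Ω → F}
    (hξ : ∀ i, Measurable (ξ i)) (hind : iIndepFun ξ μ) (i : ℕ) :
    Indep (historyFiltration hξ i) (MeasurableSpace.comap (ξ (i + 1)) inferInstance) μ := by
  suffices Indep (⨆ k ∈ {k | k ≤ i}, MeasurableSpace.comap (ξ k) inferInstance)
      (⨆ k ∈ ({i + 1} : Set ℕ), MeasurableSpace.comap (ξ k) inferInstance) μ by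
    rwa [iSup_singleton] at this
  exact indep_iSup_of_disjoint (fun k => (hξ k).comap_le) hind (by simp)

/-- Supplies the conditional variance bound required by `ae_tendsto_sum_div_of_indep`, using `v ≤ 1
+ v`. -/
lemma lintegral_sq_le_of_le_mul {F : Type*} [MeasurableSpace F] {Q : Measure F} {h ψ : F → ℝ}
    {v : ℝ} (hv : 0 ≤ v) (hh : Integrable h Q) (hh0 : ∀ z, 0 ≤ h z)
    (hψ : ∀ᵐ z ∂Q, ψ z ^ 2 ≤ v ^ 2 * h z) :
    ∫⁻ z, ENNReal.ofReal (ψ z ^ 2) ∂Q ≤ ENNReal.ofReal ((∫ z, h z ∂Q) * (1 + v) ^ 2) := by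
  rw [← integral_mul_const, ofReal_integral_eq_lintegral_ofReal (hh.mul_const _)
    (ae_of_all _ fun z => mul_nonneg (hh0 z) (sq_nonneg _))]
  refine lintegral_mono_ae ?_
  filter_upwards [hψ] with z hz
  refine ENNReal.ofReal_le_ofReal (hz.trans ?_)
  rw [mul_comm]
  have := hh0 z
  gcongr
  linarith

/-- The quadratic terms cancel to first order, `(u - m) (u + m) ≤ x * 2u`, so the martingale
difference is only linear in the workload `u`. -/
lemma workload_sq_le {r u x : ℝ} (hr : 0 ≤ r) (hx : 0 ≤ x) (hu : 0 ≤ u) :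
    (max (u - x) 0 - r / 2 * (u ^ 2 - max (u - x) 0 ^ 2)) ^ 2 ≤ u ^ 2 * (1 + r * x) ^ 2 := by
  set m := max (u - x) 0 with hm
  have hm0 : 0 ≤ m := le_max_right _ _
  have hmu : m ≤ u := max_le (by linarith) hu
  have hmx : u - x ≤ m := le_max_left _ _
  have h1 : u ^ 2 - m ^ 2 ≤ 2 * u * x := by nlinarith
  have h2 : 0 ≤ u ^ 2 - m ^ 2 := by nlinarith
  have h3 : r * (u ^ 2 - m ^ 2) ≤ r * (2 * u * x) := mul_le_mul_of_nonneg_left h1 hr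
  have h4 : 0 ≤ r * (u ^ 2 - m ^ 2) := mul_nonneg hr h2
  have h5 : 0 ≤ u * (r * x) := mul_nonneg hu (mul_nonneg hr hx)
  rw [← mul_pow]
  refine sq_le_sq' ?_ ?_ <;> linarith

variable {G : Type*} [MeasurableSpace G]

/-- In a queue with exponential interarrival times and service times `sv` of independent marks, the
average waiting time is given by the Pollaczek–Khinchine formula, also when the waiting
times are weighted by a function of the marks. -/
lemma ae_tendsto_average_lindley [IsProbabilityMeasure μ] {lam : ℝ} (hlam : 0 < lam) {κ : Measure G}
    [IsProbabilityMeasure κ] {sv : G → ℝ} (hsv : Measurable sv) (hsv0 : ∀ᵐ g ∂κ, 0 ≤ sv g)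
    (hsv2 : MemLp sv 2 κ) (hρ : lam * ∫ g, sv g ∂κ < 1)
    {ξ : ℕ → Ω → ℝ × G} (hξ : ∀ i, Measurable (ξ i)) (hind : iIndepFun ξ μ)
    (hlaw : ∀ i, μ.map (ξ i) = (expMeasure lam).prod κ)
    {φ : G → ℝ} (hφ : Measurable φ) (hφ2 : MemLp φ 2 κ) :
    ∀ᵐ ω ∂μ, Tendsto (fun n : ℕ => (∑ i ∈ Finset.range n,
        lindley (fun j => sv (ξ j ω).2) (fun j => (ξ j ω).1) i * φ (ξ i ω).2) / n) atTop
      (𝓝 ((∫ g, φ g ∂κ) *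
        (lam * (∫ g, sv g ^ 2 ∂κ) / (2 * (1 - lam * ∫ g, sv g ∂κ))))) := by
  have := isProbabilityMeasure_expMeasure hlam
  set Q := (expMeasure lam).prod κ with hQ
  set W : ℕ → Ω → ℝ := fun i ω => lindley (fun j => sv (ξ j ω).2) (fun j => (ξ j ω).1) i with hW
  -- The absolute value makes `u` nonnegative everywhere, as the law of large numbers requires; `sv`
  -- is nonnegative only almost surely.
  set u : ℕ → Ω → ℝ := fun i ω => |W i ω + sv (ξ i ω).2| with hu
  set 𝒢 := historyFiltration hξ with h𝒢
  have hsvm : ∀ {i j}, j ≤ i → Measurable[𝒢 i] (fun ω => sv (ξ j ω).2) := fun hij =>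
    (hsv.comp measurable_snd).comp (measurable_historyFiltration hξ hij)
  have hWm : ∀ i, Measurable[𝒢 i] (W i) := by
    intro i
    induction i with
    | zero => exact measurable_const
    | succ i ih =>
      have h1 : Measurable[𝒢 (i + 1)] (fun ω => (ξ (i + 1) ω).1) :=
        measurable_fst.comp (measurable_historyFiltration hξ le_rfl)
      exact (((ih.mono (𝒢.mono i.le_succ) le_rfl).add (hsvm i.le_succ)).sub h1).max
        measurable_const
  have hum : ∀ i, Measurable[𝒢 i] (u i) := fun i =>
    (continuous_abs.measurable).comp ((hWm i).add (hsvm le_rfl))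
  have hu0 : ∀ i ω, 0 ≤ u i ω := fun i ω => abs_nonneg _
  have hfst : ∀ᵐ z ∂Q, 0 < z.1 :=
    (Measure.quasiMeasurePreserving_fst (μ := expMeasure lam) (ν := κ)).ae (ae_pos_expMeasure lam)
  have hpos : ∀ᵐ ω ∂μ, ∀ i, 0 ≤ (ξ i ω).1 ∧ 0 ≤ sv (ξ i ω).2 := by
    refine ae_all_iff.2 fun i => ?_
    have h1 : ∀ᵐ z ∂Q, 0 ≤ z.1 ∧ 0 ≤ sv z.2 := by
      have h3 := (Measure.quasiMeasurePreserving_snd (μ := expMeasure lam) (ν := κ)).ae hsv0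
      filter_upwards [hfst, h3] with z h2 h3
      exact ⟨h2.le, h3⟩
    rw [← hlaw i] at h1
    exact ae_of_ae_map (hξ i).aemeasurable h1
  have hsnd : ∀ {f : G → ℝ}, ∫ z, f z.2 ∂Q = ∫ g, f g ∂κ := by
    intro f; rw [hQ, integral_fun_snd]; simp
  have hsnd_int : ∀ {f : G → ℝ}, Integrable f κ → Integrable (fun z : ℝ × G => f z.2) Q :=
    fun hf => hf.comp_snd _
  have hS1 := ae_tendsto_average_comp hξ hind hlaw (f := fun z => sv z.2) (by fun_prop)
    (hsnd_int (hsv2.integrable one_le_two))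
  have hS2 := ae_tendsto_average_comp hξ hind hlaw (f := fun z => sv z.2 ^ 2) (by fun_prop)
    (hsnd_int hsv2.integrable_sq)
  have hT := ae_tendsto_average_comp (ξ := fun i => ξ (i + 1)) (fun i => hξ (i + 1))
    (hind.precomp (add_left_injective 1)) (fun i => hlaw (i + 1)) (f := fun z => z.1)
    (by fun_prop) (by
      have := integrable_pow_expMeasure hlam 1
      simp only [pow_one] at this
      exact this.comp_fst _)
  have hTmean : ∫ z, z.1 ∂Q = 1 / lam := by
    rw [hQ, integral_fun_fst (fun x => x), integral_id_expMeasure hlam]; simp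
  rw [hsnd] at hS1
  rw [hsnd (f := fun g => sv g ^ 2)] at hS2
  rw [hTmean] at hT
  have hsum : ∀ᵐ ω ∂μ, ∃ c : ℝ, ∀ n, ∑ i ∈ Finset.range n,
      ((1 + u i ω) / ∑ j ∈ Finset.range (i + 1), (1 + u j ω)) ^ 2 ≤ c := by
    filter_upwards [hpos, hS2] with ω hω hS2
    have hue : ∀ i, u i ω = W i ω + sv (ξ i ω).2 := fun i =>
      abs_of_nonneg (add_nonneg (lindley_nonneg _ _ _) (hω i).2)
    simp_rw [hue]
    exact exists_sum_lindley_sq_le (fun i => (hω i).2) (fun i => (hω i).1) hS2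
  -- the martingales
  have hM := ae_tendsto_sum_div_of_indep (𝒢 := 𝒢) (ξ := ξ) (Q := Q)
    (fun i => measurable_historyFiltration hξ le_rfl) (indep_historyFiltration hξ hind) hlaw hum hu0
    (ψ := fun p => max (p.1 - p.2.1) 0 - lam / 2 * (p.1 ^ 2 - max (p.1 - p.2.1) 0 ^ 2))
    (by fun_prop)
    (fun v hv => by
      have := integral_fun_fst (μ := expMeasure lam) (ν := κ)
        (fun x => max (v - x) 0 - lam / 2 * (v ^ 2 - max (v - x) 0 ^ 2))
      rw [integral_workload_expMeasure hlam hv] at this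
      simpa using this)
    (C := ∫ z, (1 + lam * z.1) ^ 2 ∂Q) (integral_nonneg fun z => sq_nonneg _)
    (fun v hv => by
      refine lintegral_sq_le_of_le_mul hv ?_ (fun z => sq_nonneg _) ?_
      · have h1 : Integrable (fun x : ℝ => (1 + lam * x) ^ 2) (expMeasure lam) := by
          have e : ∀ x : ℝ, (1 + lam * x) ^ 2 = 1 + 2 * lam * x ^ 1 + lam ^ 2 * x ^ 2 := by
            intro x; ring
          simp_rw [e]
          exact ((integrable_const 1).add ((integrable_pow_expMeasure hlam 1).const_mul _)).add
            ((integrable_pow_expMeasure hlam 2).const_mul _)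
        exact h1.comp_fst _
      · filter_upwards [hfst] with z hz using workload_sq_le hlam.le hz.le hv)
    hsum
  have hMw : ∀ {f : G → ℝ}, Measurable f → MemLp f 2 κ → ∀ᵐ ω ∂μ, Tendsto (fun n : ℕ =>
      (∑ i ∈ Finset.range n, max (u i ω - (ξ (i + 1) ω).1) 0 *
        (f (ξ (i + 1) ω).2 - ∫ g, f g ∂κ)) /
        ∑ j ∈ Finset.range (n + 1), (1 + u j ω)) atTop (𝓝 0) := by
    intro f hf hf2
    have hf2' : MemLp (fun g => f g - ∫ g, f g ∂κ) 2 κ := hf2.sub (memLp_const _)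
    refine ae_tendsto_sum_div_of_indep (𝒢 := 𝒢) (ξ := ξ) (Q := Q)
      (fun i => measurable_historyFiltration hξ le_rfl) (indep_historyFiltration hξ hind) hlaw hum
      hu0 (ψ := fun p => max (p.1 - p.2.1) 0 * (f p.2.2 - ∫ g, f g ∂κ))
      (by fun_prop)
      (fun v hv => ?_)
      (C := ∫ z, (f z.2 - ∫ g, f g ∂κ) ^ 2 ∂Q) (integral_nonneg fun z => sq_nonneg _)
      (fun v hv => ?_) hsum
    · have := integral_prod_mul (μ := expMeasure lam) (ν := κ) (fun x => max (v - x) 0)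
        (fun g => f g - ∫ g, f g ∂κ)
      rw [integral_sub (hf2.integrable one_le_two) (integrable_const _)] at this
      simpa using this
    · refine lintegral_sq_le_of_le_mul hv (hsnd_int hf2'.integrable_sq) (fun z => sq_nonneg _) ?_
      filter_upwards [hfst] with z hz
      rw [mul_pow]
      gcongr
      exact max_le (by linarith) hv
  filter_upwards [hpos, hS1, hS2, hT, hM, hMw hsv hsv2, hMw hφ hφ2]
    with ω hω hS1 hS2 hT hM hM' hMφ
  have hue : ∀ i, u i ω = W i ω + sv (ξ i ω).2 := fun i =>
    abs_of_nonneg (add_nonneg (lindley_nonneg _ _ _) (hω i).2)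
  have hstep : ∀ i, max (W i ω + sv (ξ i ω).2 - (ξ (i + 1) ω).1) 0 = W (i + 1) ω :=
    fun i => rfl
  simp only [hue, hstep] at hM hM' hMφ
  obtain ⟨hlim, hlin⟩ := tendsto_lindley_average (S := fun j => sv (ξ j ω).2)
    (T := fun j => (ξ j ω).1) hlam hρ (fun i => (hω i).2) hS1 hS2 hT hM hM'
  exact tendsto_lindley_weighted_average (S := fun j => sv (ξ j ω).2)
    (T := fun j => (ξ j ω).1) (c := fun j => φ (ξ j ω).2) (fun i => (hω i).2) hlim hlin hMφ

end Marked

/-! ### Averages along a sample path -/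

/-- A finite set has frequency zero. This makes `Nat.nth` meaningful for all indices. -/
lemma infinite_of_tendsto_average {p : ℕ → Prop} [DecidablePred p] {a : ℝ} (ha : 0 < a)
    (h : Tendsto (fun n : ℕ => (∑ i ∈ Finset.range n, if p i then (1 : ℝ) else 0) / n) atTop
      (𝓝 a)) : {i | p i}.Infinite := by
  intro hfin
  have hle : ∀ n : ℕ, (∑ i ∈ Finset.range n, if p i then (1 : ℝ) else 0) ≤
      hfin.toFinset.card := by
    intro n
    rw [Finset.sum_ite, Finset.sum_const_zero, add_zero, Finset.sum_const, nsmul_eq_mul, mul_one]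
    refine Nat.cast_le.2 (Finset.card_le_card fun i hi => ?_)
    simpa using (Finset.mem_filter.1 hi).2
  have h0 : Tendsto (fun n : ℕ => (hfin.toFinset.card : ℝ) / n) atTop (𝓝 0) :=
    tendsto_const_div_atTop_nhds_zero_nat _
  exact ha.not_ge (le_of_tendsto_of_tendsto' h h0 fun n => by gcongr; exact hle n)

/-- Averages over the indices satisfying `p`. -/
lemma tendsto_average_nth {p : ℕ → Prop} [DecidablePred p] {a w : ℝ} (ha : 0 < a) {f : ℕ → ℝ}
    (h : Tendsto (fun n : ℕ => (∑ i ∈ Finset.range n, if p i then (1 : ℝ) else 0) / n) atTop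
      (𝓝 a))
    (hf : Tendsto (fun n : ℕ => (∑ i ∈ Finset.range n, if p i then f i else 0) / n) atTop
      (𝓝 (a * w))) :
    Tendsto (fun K : ℕ => (∑ k ∈ Finset.range K, f (Nat.nth p k)) / K) atTop (𝓝 w) := by
  have hinf := infinite_of_tendsto_average ha h
  have htop : Tendsto (Nat.nth p) atTop atTop := (Nat.nth_strictMono hinf).tendsto_atTop
  -- Below `Nat.nth p K` there are exactly `K` indices satisfying `p`, so the ratio of the two
  -- averages at that point is the average sought.
  have h1 := (hf.comp htop).div (h.comp htop) ha.ne'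
  rw [mul_div_cancel_left₀ _ ha.ne'] at h1
  refine h1.congr' ?_
  filter_upwards [htop.eventually_ge_atTop 1] with K hK
  have hm : ((Nat.nth p K : ℕ) : ℝ) ≠ 0 := by positivity
  have hc : Nat.count p (Nat.nth p K) = K := Nat.count_nth_of_infinite hinf K
  have e1 := sum_range_count_nth (p := p) f (Nat.nth p K)
  have e2 := sum_range_count_nth (p := p) (fun _ => 1) (Nat.nth p K)
  rw [hc] at e1 e2
  simp only [Pi.div_apply, Function.comp]
  rw [← e1, ← e2, div_div_div_cancel_right₀ hm]
  simp

lemma tendsto_average_peakAge {N : ℕ} [NeZero N] {I X : Fin N → ℕ → ℝ}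
    (hI : ∀ n k, 0 < I n k) (hX : ∀ n k, 0 < X n k) {n : Fin N} {p a b w : ℝ} (hp : 0 < p)
    (hIavg : Tendsto (fun K : ℕ => (∑ k ∈ Finset.range K, I n k) / K) atTop (𝓝 a))
    (hXavg : Tendsto (fun K : ℕ => (∑ k ∈ Finset.range K, X n k) / K) atTop (𝓝 b))
    (hcount : Tendsto (fun m : ℕ => (∑ i ∈ Finset.range m,
      if packetClass I i = n then (1 : ℝ) else 0) / m) atTop (𝓝 p))
    (hW : Tendsto (fun m : ℕ => (∑ i ∈ Finset.range m,
      if packetClass I i = n then waitingTime I X i else 0) / m) atTop (𝓝 (p * w))) :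
    Tendsto (fun K : ℕ => (1 / (K : ℝ)) * ∑ k ∈ Finset.range K, peakAge I X n k) atTop
      (𝓝 (a + b + w)) := by
  have hinf := infinite_of_tendsto_average hp hcount
  refine ((hIavg.add hXavg).add (tendsto_average_nth hp hcount hW)).congr fun K => ?_
  simp_rw [peakAge_eq hI hX hinf, Finset.sum_add_distrib]
  ring

/-! ### The law of the streams -/

section Model

variable {N : ℕ} {Ω : Type*} [MeasurableSpace Ω] {μ : Measure Ω}
  {lam x y : Fin N → ℝ} {I X : Fin N → ℕ → Ω → ℝ}

lemma IsMultiClassMG1.isProbabilityMeasure_serviceLaw [IsProbabilityMeasure μ]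
    (hq : IsMultiClassMG1 μ lam x y I X) (n : Fin N) : IsProbabilityMeasure (μ.map (X n 0)) :=
  Measure.isProbabilityMeasure_map (hq.measurable_service n 0).aemeasurable

/-- Mutual independence gives a product measure on one flat index set. Indexing by a product with
`Bool` instead of a sum type allows currying, which groups the variables first into pairs and then
into streams. -/
lemma IsMultiClassMG1.map_streams (hq : IsMultiClassMG1 μ lam x y I X)
    [∀ n, IsProbabilityMeasure (expMeasure (lam n))]
    [∀ n, IsProbabilityMeasure (μ.map (X n 0))] :
    μ.map (fun ω n j => (I n j ω, X n j ω)) = streamsLaw lam fun n => μ.map (X n 0) := by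
  have hIm := hq.measurable_interarrival
  have hXm := hq.measurable_service
  -- the family, indexed by class and number, and by the kind of the variable
  let Z : (Fin N × ℕ) × Bool → Ω → ℝ := fun p => bif p.2 then X p.1.1 p.1.2 else I p.1.1 p.1.2
  let L : Fin N × ℕ → Bool → Measure ℝ :=
    fun q b => bif b then μ.map (X q.1 0) else expMeasure (lam q.1)
  have hL : ∀ q b, IsProbabilityMeasure (L q b) := by
    rintro q (_ | _) <;> simp only [L, cond_true, cond_false] <;> infer_instance
  have hZm : ∀ p, Measurable (Z p) := by
    rintro ⟨q, _ | _⟩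
    · exact hIm _ _
    · exact hXm _ _
  have hZind : iIndepFun Z μ := by
    let g : (Fin N × ℕ) × Bool → (Fin N × ℕ) ⊕ (Fin N × ℕ) :=
      fun p => bif p.2 then Sum.inr p.1 else Sum.inl p.1
    have hg : g.Injective := by
      rintro ⟨q, _ | _⟩ ⟨q', _ | _⟩ h <;> simp_all [g]
    convert hq.indep.precomp hg using 1
    funext p
    obtain ⟨q, _ | _⟩ := p <;> rfl
  have hZlaw : ∀ p, HasLaw (Z p) (L p.1 p.2) μ := by
    rintro ⟨q, _ | _⟩
    · exact hq.interarrival_law _ _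
    · exact ⟨(hXm _ _).aemeasurable, (hq.service_identDistrib _ _).map_eq⟩
  have h1 : μ.map (fun ω p => Z p ω) = Measure.infinitePi fun p : (Fin N × ℕ) × Bool => L p.1 p.2 :=
    (hZind.hasLaw_infinitePi hZlaw (measurable_pi_iff.2 hZm).aemeasurable).map_eq
  have hcm : Measurable (MeasurableEquiv.curry (Fin N × ℕ) Bool ℝ) := MeasurableEquiv.measurable _
  have hZm' : Measurable (fun ω p => Z p ω) := measurable_pi_iff.2 hZm
  -- pairs
  let pair : (Bool → ℝ) → ℝ × ℝ := fun f => (f false, f true)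
  have hpair : Measurable pair := by fun_prop
  have hpm : Measurable (fun (f : Fin N × ℕ → Bool → ℝ) q => pair (f q)) :=
    measurable_pi_lambda _ fun q => hpair.comp (measurable_pi_apply q)
  have hL2 : ∀ q, (Measure.infinitePi (L q)).map pair = (expMeasure (lam q.1)).prod (μ.map (X q.1 0)) :=
    fun q => Measure.infinitePi_map_eval_prod (P := L q) Bool.false_ne_true
  have h2 : μ.map (fun ω (q : Fin N × ℕ) => (I q.1 q.2 ω, X q.1 q.2 ω)) =
      Measure.infinitePi fun q : Fin N × ℕ => (expMeasure (lam q.1)).prod (μ.map (X q.1 0)) := by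
    have h3 := congrArg (Measure.map (MeasurableEquiv.curry (Fin N × ℕ) Bool ℝ)) h1
    rw [Measure.infinitePi_map_curry, Measure.map_map hcm hZm'] at h3
    have h4 := congrArg (Measure.map fun (f : Fin N × ℕ → Bool → ℝ) q => pair (f q)) h3
    rw [Measure.map_map hpm (hcm.comp hZm'),
      Measure.infinitePi_map_pi (fun q => Measure.infinitePi (L q)) (fun _ => hpair)] at h4
    simp_rw [hL2] at h4
    exact h4
  have h5 := congrArg (Measure.map (MeasurableEquiv.curry (Fin N) ℕ (ℝ × ℝ))) h2
  rw [Measure.infinitePi_map_curry (fun (n : Fin N) (_ : ℕ) =>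
      (expMeasure (lam n)).prod (μ.map (X n 0))),
    Measure.map_map (MeasurableEquiv.measurable _)
      (measurable_pi_lambda _ fun q => (hIm _ _).prodMk (hXm _ _)),
    Measure.infinitePi_eq_pi] at h5
  exact h5

end Model

/-! ### Integrals with respect to the law of the marks -/

section MarkIntegrals

variable {N : ℕ} {lam : Fin N → ℝ} {ν : Fin N → Measure ℝ}

lemma ae_markLaw {p : Fin N × ℝ → Prop} (hp : MeasurableSet {z | p z})
    (h : ∀ n, ∀ᵐ s ∂ν n, p (n, s)) : ∀ᵐ z ∂markLaw lam ν, p z := by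
  rw [ae_iff]
  change markLaw lam ν {z | p z}ᶜ = 0
  rw [← lintegral_indicator_one hp.compl,
    lintegral_markLaw lam ν (measurable_one.indicator hp.compl)]
  refine Finset.sum_eq_zero fun n _ => ?_
  have h0 : ∫⁻ s, {z | p z}ᶜ.indicator 1 (n, s) ∂ν n = 0 := by
    rw [← lintegral_zero (μ := ν n)]
    refine lintegral_congr_ae ?_
    filter_upwards [h n] with s hs
    have hn : (n, s) ∉ {z | p z}ᶜ := fun hn => hn hs
    exact Set.indicator_of_notMem hn _
  rw [h0, mul_zero]

lemma integrable_markLaw {f : Fin N × ℝ → ℝ} (hf : Measurable f)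
    (h : ∀ n, Integrable (fun s => f (n, s)) (ν n)) : Integrable f (markLaw lam ν) := by
  rw [markLaw, integrable_finsetSum_measure]
  intro n _
  refine Integrable.smul_measure ?_ ENNReal.ofReal_ne_top
  rw [integrable_map_measure hf.aestronglyMeasurable measurable_prodMk_left.aemeasurable]
  exact h n

lemma integral_markLaw (hlam : ∀ n, 0 < lam n) {f : Fin N × ℝ → ℝ} (hf : Measurable f)
    (h : ∀ n, Integrable (fun s => f (n, s)) (ν n)) :
    ∫ z, f z ∂markLaw lam ν = (∑ n, lam n * ∫ s, f (n, s) ∂ν n) / ∑ m, lam m := by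
  have hi := integrable_markLaw (lam := lam) hf h
  rw [markLaw, integrable_finsetSum_measure] at hi
  rw [markLaw, integral_finsetSum_measure hi, Finset.sum_div]
  refine Finset.sum_congr rfl fun n _ => ?_
  have h0 : 0 ≤ ∑ m, lam m := Finset.sum_nonneg fun m _ => (hlam m).le
  rw [integral_smul_measure, integral_map measurable_prodMk_left.aemeasurable
    hf.aestronglyMeasurable, ENNReal.toReal_ofReal (div_nonneg (hlam n).le h0), smul_eq_mul]
  ring

end MarkIntegrals

/-! ### Almost sure averages in the multi-class queue -/

section Main

variable {N : ℕ} {Ω : Type*} [MeasurableSpace Ω] {μ : Measure Ω}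
  {lam x y : Fin N → ℝ} {I X : Fin N → ℕ → Ω → ℝ}

lemma IsMultiClassMG1.ae_tendsto_average_interarrival (hq : IsMultiClassMG1 μ lam x y I X)
    (n : Fin N) : ∀ᵐ ω ∂μ, Tendsto (fun K : ℕ => (∑ k ∈ Finset.range K, I n k ω) / K) atTop
      (𝓝 (1 / lam n)) := by
  have hind : iIndepFun (I n) μ := hq.indep.precomp (g := fun k : ℕ => Sum.inl (n, k))
    fun k l h => by simpa using h
  have h1 := ae_tendsto_average_comp (fun k => hq.measurable_interarrival n k) hind
    (fun k => (hq.interarrival_law n k).map_eq) (f := fun z => z) measurable_id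
    (by simpa only [pow_one] using integrable_pow_expMeasure (hq.rate_pos n) 1)
  rwa [integral_id_expMeasure (hq.rate_pos n)] at h1

lemma IsMultiClassMG1.ae_tendsto_average_service [IsProbabilityMeasure μ]
    (hq : IsMultiClassMG1 μ lam x y I X)
    (n : Fin N) : ∀ᵐ ω ∂μ, Tendsto (fun K : ℕ => (∑ k ∈ Finset.range K, X n k ω) / K) atTop
      (𝓝 (x n)) := by
  have hind : iIndepFun (X n) μ := hq.indep.precomp (g := fun k : ℕ => Sum.inr (n, k))
    fun k l h => by simpa using h
  have h1 := strong_law_ae_real (X n) ((hq.service_memLp n).integrable one_le_two)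
    (fun i j hij => hind.indepFun hij) (hq.service_identDistrib n)
  rwa [hq.service_mean n] at h1

variable [NeZero N] [IsProbabilityMeasure μ]

/-- In the order of arrival, the packets have independent exponential interarrival times, and
independent marks (class and service time). -/
lemma IsMultiClassMG1.exists_packets (hq : IsMultiClassMG1 μ lam x y I X) :
    ∃ ξ : ℕ → Ω → ℝ × (Fin N × ℝ), (∀ i, Measurable (ξ i)) ∧ iIndepFun ξ μ ∧
      (∀ i, μ.map (ξ i) =
        (expMeasure (∑ m, lam m)).prod (markLaw lam fun n => μ.map (X n 0))) ∧
      ∀ᵐ ω ∂μ, ∀ i, ξ i ω = (interTime (fun n k => I n k ω) i, packetClass (fun n k => I n k ω) i,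
        serviceTime (fun n k => I n k ω) (fun n k => X n k ω) i) := by
  have hlam := hq.rate_pos
  have hexp : ∀ n, IsProbabilityMeasure (expMeasure (lam n)) := fun n =>
    isProbabilityMeasure_expMeasure (hlam n)
  have hν := hq.isProbabilityMeasure_serviceLaw
  have := isProbabilityMeasure_expMeasure
    (Finset.sum_pos (fun n _ => hlam n) Finset.univ_nonempty : 0 < ∑ m, lam m)
  have := isProbabilityMeasure_markLaw (fun n => μ.map (X n 0)) hlam
  set Q := (expMeasure (∑ m, lam m)).prod (markLaw lam fun n => μ.map (X n 0)) with hQ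
  set P := streamsLaw lam fun n => μ.map (X n 0) with hP
  set e₀ : Ω → Fin N → ℕ → ℝ × ℝ := fun ω n j => (I n j ω, X n j ω) with he₀
  have he₀m : Measurable e₀ := measurable_pi_lambda _ fun n => measurable_pi_lambda _ fun j =>
    (hq.measurable_interarrival n j).prodMk (hq.measurable_service n j)
  have hlaw : μ.map e₀ = P := hq.map_streams
  have hstep := map_firstPacket_nextStreams lam (fun n => μ.map (X n 0)) hlam
  have hiter := map_iterate_eq_infinitePi measurable_firstPacket measurable_nextStreams hstep
  have hpm : Measurable (fun e (i : ℕ) => firstPacket (N := N) (nextStreams^[i] e)) :=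
    measurable_pi_lambda _ fun i => measurable_firstPacket.comp (measurable_nextStreams.iterate i)
  have hξm : ∀ i, Measurable (fun ω => firstPacket (nextStreams^[i] (e₀ ω))) := fun i =>
    (measurable_firstPacket.comp (measurable_nextStreams.iterate i)).comp he₀m
  have hjoint : μ.map (fun ω (i : ℕ) => firstPacket (nextStreams^[i] (e₀ ω))) =
      Measure.infinitePi fun _ : ℕ => Q := by
    rw [← hiter, ← hP, ← hlaw, Measure.map_map hpm he₀m]
    rfl
  have hmarg : ∀ i, μ.map (fun ω => firstPacket (nextStreams^[i] (e₀ ω))) = Q := by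
    intro i
    rw [← Measure.infinitePi_map_eval (fun _ : ℕ => Q) i, ← hjoint,
      Measure.map_map (measurable_pi_apply i) (measurable_pi_lambda _ hξm)]
    rfl
  refine ⟨fun i ω => firstPacket (nextStreams^[i] (e₀ ω)), hξm, ?_, hmarg, ?_⟩
  · rw [iIndepFun_iff_map_fun_eq_infinitePi_map hξm, hjoint]
    simp_rw [hmarg]
  -- The second marginal of `hstep` shows that the law is invariant, so the absence of ties at the
  -- first arrival carries over to every later one.
  · have hpres : MeasurePreserving nextStreams P P := by
      refine ⟨measurable_nextStreams, ?_⟩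
      have h1 := congrArg (Measure.map Prod.snd) hstep
      rw [Measure.map_map measurable_snd
        (measurable_firstPacket.prodMk measurable_nextStreams), ← Measure.snd, Measure.snd_prod] at h1
      exact h1
    have hmin : ∀ᵐ ω ∂μ, ∀ i, ∃ n, FirstIs n (nextStreams^[i] (e₀ ω)) := by
      refine ae_all_iff.2 fun i => ?_
      have h1 : ∀ᵐ e ∂P, ∃ n, FirstIs n e := ae_exists_firstIs lam _ hlam
      have h2 := (hpres.iterate i).quasiMeasurePreserving.ae h1
      rw [← hlaw] at h2
      exact ae_of_ae_map he₀m.aemeasurable h2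
    filter_upwards [hmin] with ω hω i
    exact firstPacket_iterate_nextStreams hω i

/-- Averages of the waiting times: of all packets, and of the packets of a class. -/
lemma IsMultiClassMG1.ae_tendsto_average_waitingTime (hq : IsMultiClassMG1 μ lam x y I X)
    (hrho : ∑ j, lam j * x j < 1) {φ : Fin N → ℝ} :
    ∀ᵐ ω ∂μ,
      Tendsto (fun m : ℕ => (∑ i ∈ Finset.range m,
        φ (packetClass (fun n k => I n k ω) i)) / m) atTop
        (𝓝 ((∑ n, lam n * φ n) / ∑ n, lam n)) ∧
      Tendsto (fun m : ℕ => (∑ i ∈ Finset.range m,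
        waitingTime (fun n k => I n k ω) (fun n k => X n k ω) i *
          φ (packetClass (fun n k => I n k ω) i)) / m) atTop
        (𝓝 ((∑ n, lam n * φ n) / (∑ n, lam n) *
          ((∑ j, lam j * y j) / (2 * (1 - ∑ j, lam j * x j))))) := by
  have hlam := hq.rate_pos
  have hν := hq.isProbabilityMeasure_serviceLaw
  have hL : 0 < ∑ m, lam m := Finset.sum_pos (fun n _ => hlam n) Finset.univ_nonempty
  have := isProbabilityMeasure_expMeasure hL
  have := isProbabilityMeasure_markLaw (fun n => μ.map (X n 0)) hlam
  set κ := markLaw lam fun n => μ.map (X n 0) with hκ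
  have hX0 : ∀ n, AEMeasurable (X n 0) μ := fun n => (hq.measurable_service n 0).aemeasurable
  have hint1 : ∀ n, Integrable (fun s : ℝ => s) (μ.map (X n 0)) := fun n =>
    (integrable_map_measure (by fun_prop) (hX0 n)).2 ((hq.service_memLp n).integrable one_le_two)
  have hint2 : ∀ n, Integrable (fun s : ℝ => s ^ 2) (μ.map (X n 0)) := fun n =>
    (integrable_map_measure (by fun_prop) (hX0 n)).2 (hq.service_memLp n).integrable_sq
  have hmean : ∫ z, z.2 ∂κ = (∑ n, lam n * x n) / ∑ m, lam m := by
    rw [hκ, integral_markLaw hlam measurable_snd hint1]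
    congr 1
    refine Finset.sum_congr rfl fun n _ => ?_
    rw [integral_map (hX0 n) (by fun_prop), hq.service_mean]
  have hmean2 : ∫ z, z.2 ^ 2 ∂κ = (∑ n, lam n * y n) / ∑ m, lam m := by
    rw [hκ, integral_markLaw hlam (f := fun z => z.2 ^ 2) (by fun_prop) hint2]
    congr 1
    refine Finset.sum_congr rfl fun n _ => ?_
    rw [integral_map (hX0 n) (by fun_prop), hq.service_secondMoment]
  have hsv0 : ∀ᵐ z ∂κ, 0 ≤ z.2 := by
    refine ae_markLaw (measurableSet_le measurable_const measurable_snd) fun n => ?_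
    refine (ae_map_iff (p := fun s => (0 : ℝ) ≤ s) (hX0 n)
      (measurableSet_le measurable_const measurable_id)).2 ?_
    filter_upwards [hq.service_pos n 0] with ω hω using hω.le
  have hsv2 : MemLp (fun z : Fin N × ℝ => z.2) 2 κ :=
    (memLp_two_iff_integrable_sq (by fun_prop)).2
      (integrable_markLaw (f := fun z => z.2 ^ 2) (by fun_prop) hint2)
  have hφm : Measurable (fun z : Fin N × ℝ => φ z.1) :=
    (measurable_of_countable φ).comp measurable_fst
  have hφ2 : MemLp (fun z : Fin N × ℝ => φ z.1) 2 κ :=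
    (memLp_two_iff_integrable_sq hφm.aestronglyMeasurable).2
      (integrable_markLaw (hφm.pow_const 2) fun n => integrable_const (φ n ^ 2))
  have hφmean : ∫ z, φ z.1 ∂κ = (∑ n, lam n * φ n) / ∑ m, lam m := by
    rw [hκ, integral_markLaw hlam hφm fun n => integrable_const (φ n)]
    simp
  have hρ : (∑ m, lam m) * ∫ z, z.2 ∂κ = ∑ n, lam n * x n := by
    rw [hmean, mul_div_cancel₀ _ hL.ne']
  obtain ⟨ξ, hξm, hind, hlaw, hξ⟩ := hq.exists_packets
  have hW := ae_tendsto_average_lindley hL measurable_snd hsv0 hsv2 (by rw [hρ]; exact hrho)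
    hξm hind hlaw hφm hφ2
  have hC := ae_tendsto_average_comp hξm hind hlaw (f := fun z => φ z.2.1)
    (hφm.comp measurable_snd) ((hφ2.integrable one_le_two).comp_snd _)
  have hCmean : ∫ z, φ z.2.1 ∂(expMeasure (∑ m, lam m)).prod κ =
      (∑ n, lam n * φ n) / ∑ m, lam m := by
    rw [integral_fun_snd (fun z : Fin N × ℝ => φ z.1), hφmean]; simp
  rw [hCmean] at hC
  -- The total rate cancels the normalization of the mark law, in the load as well as in the second
  -- moment.
  rw [hφmean, hρ, hmean2, mul_div_cancel₀ _ hL.ne'] at hW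
  filter_upwards [hξ, hW, hC] with ω hω hW hC
  simp only [hω] at hW hC
  refine ⟨hC, ?_⟩
  simp_rw [waitingTime_eq_lindley]
  exact hW

lemma IsMultiClassMG1.isMeanWaitingTime (hq : IsMultiClassMG1 μ lam x y I X)
    (hrho : ∑ j, lam j * x j < 1) :
    IsMeanWaitingTime μ I X ((∑ j, lam j * y j) / (2 * (1 - ∑ j, lam j * x j))) := by
  have hL : 0 < ∑ m, lam m := Finset.sum_pos (fun n _ => hq.rate_pos n) Finset.univ_nonempty
  filter_upwards [hq.ae_tendsto_average_waitingTime hrho (φ := fun _ => 1)] with ω hω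
  have h := hω.2
  simp only [mul_one, div_self hL.ne', one_mul] at h
  exact h.congr fun K => by rw [div_eq_inv_mul, one_div]

lemma IsMultiClassMG1.isPeakAoI (hq : IsMultiClassMG1 μ lam x y I X)
    (hrho : ∑ j, lam j * x j < 1) (n : Fin N) :
    IsPeakAoI μ I X n
      (1 / lam n + x n + (∑ j, lam j * y j) / (2 * (1 - ∑ j, lam j * x j))) := by
  have hL : 0 < ∑ m, lam m := Finset.sum_pos (fun n _ => hq.rate_pos n) Finset.univ_nonempty
  have hI : ∀ᵐ ω ∂μ, ∀ n k, 0 < I n k ω :=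
    ae_all_iff.2 fun n => ae_all_iff.2 fun k =>
      ae_of_ae_map (hq.measurable_interarrival n k).aemeasurable
        (by rw [(hq.interarrival_law n k).map_eq]; exact ae_pos_expMeasure _)
  have hX : ∀ᵐ ω ∂μ, ∀ n k, 0 < X n k ω :=
    ae_all_iff.2 fun n => ae_all_iff.2 fun k => hq.service_pos n k
  filter_upwards [hI, hX, hq.ae_tendsto_average_interarrival n, hq.ae_tendsto_average_service n,
    hq.ae_tendsto_average_waitingTime hrho (φ := fun m => if m = n then 1 else 0)]
    with ω hI hX hIavg hXavg ⟨hC, hW⟩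
  simp only [mul_ite, mul_one, mul_zero, Finset.sum_ite_eq', Finset.mem_univ, if_true] at hC hW
  exact tendsto_average_peakAge hI hX (div_pos (hq.rate_pos n) hL) hIavg hXavg hC hW

/-- An almost sure event of a probability measure is nonempty, and a single path on which both
limits hold identifies them. -/
lemma IsPeakAoI.unique {n : Fin N} {a b : ℝ} (ha : IsPeakAoI μ I X n a)
    (hb : IsPeakAoI μ I X n b) : a = b := by
  obtain ⟨ω, h1, h2⟩ := (ha.and hb).exists
  exact tendsto_nhds_unique h1 h2

lemma IsMeanWaitingTime.unique {a b : ℝ} (ha : IsMeanWaitingTime μ I X a)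
    (hb : IsMeanWaitingTime μ I X b) : a = b := by
  obtain ⟨ω, h1, h2⟩ := (ha.and hb).exists
  exact tendsto_nhds_unique h1 h2

end Main

end MG1

theorem mainTheorem1 {N : ℕ} [NeZero N] {Ω : Type*} [MeasurableSpace Ω]
    (μ : Measure Ω) [IsProbabilityMeasure μ]
    (lam x y : Fin N → ℝ) (I X : Fin N → ℕ → Ω → ℝ)
    (hq : MG1.IsMultiClassMG1 μ lam x y I X)
    (hrho : ∑ j, lam j * x j < 1) :
    -- the peak age-of-information of every class
    (∀ n, MG1.IsPeakAoI μ I X n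
      (1 / lam n + x n + (∑ j, lam j * y j) / (2 * (1 - ∑ j, lam j * x j)))) ∧
    -- the mean waiting time
    MG1.IsMeanWaitingTime μ I X ((∑ j, lam j * y j) / (2 * (1 - ∑ j, lam j * x j))) ∧
    -- conservation law and relation between the classes
    (∀ (A : Fin N → ℝ) (W : ℝ), (∀ n, MG1.IsPeakAoI μ I X n (A n)) →
      MG1.IsMeanWaitingTime μ I X W →
        ∑ n, lam n * A n = (N : ℝ) + ∑ j, lam j * x j + (∑ j, lam j) * W ∧
        (∀ n m, A n - 1 / lam n - x n = A m - 1 / lam m - x m) ∧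
        (∀ n m, 1 / lam n - 1 / lam m = (A n - x n) - (A m - x m)) ∧
        (∀ n m, lam n < lam m → A m - x m < A n - x n)) := by
  have hA := hq.isPeakAoI hrho
  have hW := hq.isMeanWaitingTime hrho
  refine ⟨hA, hW, fun A W hA' hW' => ?_⟩
  -- By uniqueness, `A` and `W` are the explicit limits; the remaining claims are algebra in `A n =
  -- 1 / lam n + x n + W`.
  have eW := hW'.unique hW
  have eA : ∀ n, A n = 1 / lam n + x n + W := fun n => by
    rw [eW]; exact (hA' n).unique (hA n)
  refine ⟨?_, fun n m => ?_, fun n m => ?_, fun n m hnm => ?_⟩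
  · have e : ∀ n, lam n * A n = 1 + lam n * x n + lam n * W := fun n => by
      have := (hq.rate_pos n).ne'
      rw [eA]; field_simp
    simp_rw [e, Finset.sum_add_distrib, Finset.sum_mul]
    simp
  · rw [eA, eA]; ring
  · rw [eA, eA]; ring
  · rw [eA, eA]
    have := one_div_lt_one_div_of_lt (hq.rate_pos n) hnm
    linarith
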